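/- Let $(W,S)$ be a Coxeter group of finite rank, $|S|<\infty$, with Coxeter matrix $(m_{rt})_{r,t\in S}$, where $m_{rt}=\infty$ is allowed. All representations are over $\mathbb{C}$. A linear map $f:V\to V$ is a *reflection* with *reflection vector* $\alpha$ if $\alpha\neq 0$, $f(\alpha)=-\alpha$, and $f$ is the identity on some subspace of codimension one. A *generalized geometric representation* of $W$ is a representation $V$ in which every $s\in S$ acts by a reflection and the reflection vectors $\alpha_s$ $(s\in S)$ form a basis of $V$. For each $z\in\mathbb{C}$ fix a square root $u(z)$ of $z$, positive if $z$ is a positive real. For $r\ne t$ in $S$ and $x,y\in\mathbb{C}$, consider the operators on $\mathbb{C}\beta_r\oplus\mathbb{C}\beta_t$ given by $$r\beta_r=-\beta_r,\quad r\beta_t=\beta_t+x\beta_r,\quad t\beta_t=-\beta_t,\quad t\beta_r=\beta_r+y\beta_t .$$ For $m_{rt}<\infty$ and $1\le k\le m_{rt}/2$ let $\rho_k$ be the representation of the dihedral group $\langle r,t\mid r^2=t^2=(rt)^{m_{rt}}=e\rangle$ with $x=y=2\cos\frac{k\pi}{m_{rt}}$. For $m_{rt}=\infty$ let $\varrho_r^t$,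 $\varrho_t^r$, $\varrho_z$ be the representations of $\langle r,t\mid r^2=t^2=e\rangle$ with $(x,y)=(1,0)$, $(0,1)$, $(u(z),u(z))$ respectively. Let $$P_{rt}=P_{tr}=\begin{cases}\{\rho_k\mid k\in\mathbb{N},\ 1\le k\le m_{rt}/2\}, & m_{rt}<\infty,\\ \{\varrho_r^t,\varrho_t^r\}\cup\{\varrho_z\mid z\in\mathbb{C}\}, & m_{rt}=\infty.\end{cases}$$ Given $\delta=(\delta_{rt})_{r\ne t}$ with $\delta_{rt}=\delta_{tr}\in P_{rt}$, define a Coxeter matrix by $\widetilde m_{ss}=1$ and, for $r\neq t$: $\widetilde m_{rt}=m_{rt}/\gcd(m_{rt},k)$ if $m_{rt}<\infty$ and $\delta_{rt}=\rho_k$; if $m_{rt}=\infty$, then $\widetilde m_{rt}=2$ if $\delta_{rt}=\varrho_0$, $\widetilde m_{rt}=n$ if $\delta_{rt}=\varrho_z$ with $z=4\cos^2\frac{k\pi}{n}$ for coprime $k,n$ with $1\le k<n/2$, and $\widetilde m_{rt}=\infty$ otherwise. The *associated graph* $\widetilde G=\widetilde G(\delta)$ has vertex set $S$ and an edge $\{r,t\}$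 whenever $\widetilde m_{rt}\ge 3$ (including $\infty$). Let $C_1(\widetilde G)$ be the abelian group generated by the oriented edges, with $(s,t)=-(t,s)$, let $\partial(s,t)=t-s$, and let $H_1(\widetilde G)=\ker\partial$. A *character* of $H_1(\widetilde G)$ is a homomorphism $H_1(\widetilde G)\to\mathbb{C}^\times$. A *GGR-datum* is a family $(\delta_{rt},a_r^t)_{r\ne t}$ with $\delta$ as above and $a_r^t\in\mathbb{C}^\times$. It defines the action of $W$ on $V=\bigoplus_{s\in S}\mathbb{C}\alpha_s$ given by $r\alpha_r=-\alpha_r$ and $r\alpha_t=\alpha_t+c\,\frac{a_r^t}{a_t^r}\alpha_r$ for $t\ne r$, where $\delta_{rt}(r)\beta_t=\beta_t+c\beta_r$. Its *associated character* $\chi$ is the restriction to $H_1(\widetilde G)$ of the homomorphism $C_1(\widetilde G)\to\mathbb{C}^\times$, $(r,t)\mapsto a_t^r/a_r^t$. **Theorem.** Every GGR-datum defines in this way a generalized geometric representation of $W$, and every generalized geometric representation of $W$ is defined, up to isomorphism, by some GGR-datum. Sending the isomorphism class of the representation defined by $(\delta_{rt},a_r^t)_{r\neq t}$ to $((\delta_{rt})_{r\ne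 t},\chi)$, with $\chi$ the associated character, is a well-defined bijection from the set of isomorphism classes of generalized geometric representations of $W$ onto the set $$\bigl\{((\delta_{rt})_{r\ne t},\chi)\ \big|\ \delta_{rt}=\delta_{tr}\in P_{rt}\ (r\ne t),\ \chi\text{ a character of }H_1(\widetilde G(\delta))\bigr\}.$$ Moreover, if $V$ corresponds to $((\delta_{rt})_{r\ne t},\chi)$, then for all $r\ne t$ the span of the reflection vectors of $r$ and $t$ in $V$, as a representation of the dihedral group with generators $r,t$, is isomorphic to $\delta_{rt}$. -/

import Mathlib

universe u w v

/-! ### Reflections and generalized geometric representations -/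

/-- `α` is a reflection vector of the linear map `f`: `f` fixes pointwise a subspace of codimension
one, `α ≠ 0`, and `f α = -α`. -/
def IsReflectionVector {V : Type*} [AddCommGroup V] [Module ℂ V]
    (f : Module.End ℂ V) (α : V) : Prop :=
  α ≠ 0 ∧ f α = -α ∧ ∃ H : Submodule ℂ V, Module.finrank ℂ (V ⧸ H) = 1 ∧ ∀ x ∈ H, f x = x

/-- A linear map is a reflection if it has a reflection vector. -/
def IsReflection {V : Type*} [AddCommGroup V] [Module ℂ V] (f : Module.End ℂ V) : Prop :=
  ∃ α : V, IsReflectionVector f α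

/-- Every simple generator acts by a reflection. -/
def IsReflectionRep {B : Type u} {M : CoxeterMatrix B} {W : Type w} [Group W]
    (cs : CoxeterSystem M W) {V : Type*} [AddCommGroup V] [Module ℂ V]
    (ρ : Representation ℂ W V) : Prop :=
  ∀ s : B, IsReflection (ρ (cs.simple s))

/-- A reflection representation whose reflection vectors form a basis. -/
def IsGeneralizedGeometric {B : Type u} {M : CoxeterMatrix B} {W : Type w} [Group W]
    (cs : CoxeterSystem M W) {V : Type*} [AddCommGroup V] [Module ℂ V]
    (ρ : Representation ℂ W V) : Prop :=
  IsReflectionRep cs ρ ∧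
    ∃ α : Module.Basis B ℂ V, ∀ s : B, IsReflectionVector (ρ (cs.simple s)) (α s)

/-- A generalized geometric representation of the Coxeter group, bundled. -/
structure GGRep {B : Type u} {M : CoxeterMatrix B} {W : Type w} [Group W]
    (cs : CoxeterSystem M W) where
  V : Type v
  [addCommGroup : AddCommGroup V]
  [module : Module ℂ V]
  ρ : Representation ℂ W V
  isGeneralizedGeometric : IsGeneralizedGeometric cs ρ

attribute [instance] GGRep.addCommGroup GGRep.module

/-- Isomorphism of representations of the Coxeter group. -/
instance GGRep.isoSetoid {B : Type u} {M : CoxeterMatrix B} {W : Type w} [Group W]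
    (cs : CoxeterSystem M W) : Setoid (GGRep.{u, w, v} cs) where
  r X Y := Nonempty (X.ρ.Equiv Y.ρ)
  iseqv :=
    { refl := fun X => ⟨Representation.Equiv.refl X.ρ⟩
      symm := fun ⟨f⟩ => ⟨f.symm⟩
      trans := fun ⟨f⟩ ⟨g⟩ => ⟨f.trans g⟩ }

/-- Isomorphism classes of generalized geometric representations. -/
def GGRepClass {B : Type u} {M : CoxeterMatrix B} {W : Type w} [Group W]
    (cs : CoxeterSystem M W) : Type _ :=
  Quotient (GGRep.isoSetoid.{u, w, v} cs)

/-! ### Two-dimensional representations of dihedral groups -/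

/-- The Coxeter matrix of the dihedral group with generators `0`, `1` and `m` the order of their
product (`m = 0` stands for `∞`). -/
def dihedralMatrix (m : ℕ) (hm : m ≠ 1) : CoxeterMatrix (Fin 2) where
  M := Matrix.of fun i j => if i = j then 1 else m
  isSymm := by
    ext i j
    simp [Matrix.transpose_apply, eq_comm]
  diagonal i := by simp
  off_diagonal i j h := by simp [h, hm]

/-- The operators of the two generators, in the basis `β₀`, `β₁` :
`0 · β₀ = -β₀`, `0 · β₁ = β₁ + x β₀`, `1 · β₁ = -β₁`, `1 · β₀ = β₀ + y β₁`. -/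
noncomputable def dihedralGen (x y : ℂ) : Fin 2 → Module.End ℂ (Fin 2 → ℂ) :=
  ![Matrix.toLinAlgEquiv' !![-1, x; 0, 1], Matrix.toLinAlgEquiv' !![1, 0; y, -1]]

theorem dihedralGen_sq (x y : ℂ) (i : Fin 2) : dihedralGen x y i * dihedralGen x y i = 1 := by
  fin_cases i <;>
    simp [dihedralGen, ← map_mul, ← Matrix.one_fin_two]

theorem dihedralGen_isLiftable (m : ℕ) (hm : m ≠ 1) (x y : ℂ)
    (h : (dihedralGen x y 0 * dihedralGen x y 1) ^ m = 1) :
    (dihedralMatrix m hm).IsLiftable (dihedralGen x y) := by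
  have h0 := dihedralGen_sq x y 0
  have h1 := dihedralGen_sq x y 1
  have key : (dihedralGen x y 1 * dihedralGen x y 0) ^ m = 1 := by
    have e : (dihedralGen x y 1 * dihedralGen x y 0) ^ m *
        (dihedralGen x y 0 * dihedralGen x y 1) ^ m = 1 := by
      have hc : (dihedralGen x y 1 * dihedralGen x y 0) *
          (dihedralGen x y 0 * dihedralGen x y 1) = 1 := by
        rw [mul_assoc, ← mul_assoc (dihedralGen x y 0), h0, one_mul, h1]
      have hd : (dihedralGen x y 0 * dihedralGen x y 1) *
          (dihedralGen x y 1 * dihedralGen x y 0) = 1 := by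
        rw [mul_assoc, ← mul_assoc (dihedralGen x y 1), h1, one_mul, h0]
      have hcomm : Commute (dihedralGen x y 1 * dihedralGen x y 0)
          (dihedralGen x y 0 * dihedralGen x y 1) := hc.trans hd.symm
      rw [← hcomm.mul_pow, hc, one_pow]
    rwa [h, mul_one] at e
  intro i j
  fin_cases i <;> fin_cases j
  · simpa [dihedralMatrix] using h0
  · simpa [dihedralMatrix] using h
  · simpa [dihedralMatrix] using key
  · simpa [dihedralMatrix] using h1

/-- The representation of the dihedral group on `ℂβ₀ ⊕ ℂβ₁` with parameters `x`, `y`. -/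
noncomputable def dihedralRep (m : ℕ) (hm : m ≠ 1) (x y : ℂ)
    (h : (dihedralGen x y 0 * dihedralGen x y 1) ^ m = 1) :
    Representation ℂ (dihedralMatrix m hm).Group (Fin 2 → ℂ) :=
  (dihedralMatrix m hm).toCoxeterSystem.lift
    ⟨dihedralGen x y, dihedralGen_isLiftable m hm x y h⟩

theorem dihedralGen_rho_pow (m k : ℕ) (hk : 1 ≤ k) (hkm : 2 * k ≤ m) :
    (dihedralGen (2 * Real.cos (k * Real.pi / m) : ℝ) (2 * Real.cos (k * Real.pi / m) : ℝ) 0 *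
      dihedralGen (2 * Real.cos (k * Real.pi / m) : ℝ)
        (2 * Real.cos (k * Real.pi / m) : ℝ) 1) ^ m = 1 := by
  set θ : ℝ := k * Real.pi / m with hθ
  have hm0 : (0 : ℝ) < m := by
    have : 0 < m := by omega
    exact_mod_cast this
  have hk0 : (0 : ℝ) < k := by exact_mod_cast hk
  set A : Matrix (Fin 2) (Fin 2) ℂ :=
    !![-1, ((2 * Real.cos θ : ℝ) : ℂ); 0, 1] * !![1, 0; ((2 * Real.cos θ : ℝ) : ℂ), -1] with hA
  suffices hpow : A ^ m = 1 by
    simp only [dihedralGen, Matrix.cons_val_zero, Matrix.cons_val_one]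
    rw [← map_mul, ← map_pow, ← hA, hpow, map_one]
  rcases eq_or_lt_of_le hkm with heq | hlt
  · have hc : Real.cos θ = 0 := by
      have : θ = Real.pi / 2 := by
        rw [hθ, ← heq]
        push_cast
        field_simp
      rw [this, Real.cos_pi_div_two]
    have hA1 : A = -1 := by
      rw [hA, hc]
      ext i j
      fin_cases i <;> fin_cases j <;> simp
    rw [hA1, ← heq, pow_mul]
    simp
  · have hmθ : (m : ℝ) * θ = k * Real.pi := by
      rw [hθ]
      field_simp
    have hquad : A * A = ((2 * Real.cos (2 * θ) : ℝ) : ℂ) • A - 1 := by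
      rw [Real.cos_two_mul, hA]
      ext i j
      fin_cases i <;> fin_cases j <;> simp [Matrix.one_fin_two] <;> ring
    have hrec : ∀ n : ℕ, ((Real.sin (2 * θ) : ℝ) : ℂ) • A ^ n =
        ((Real.sin (n * (2 * θ)) : ℝ) : ℂ) • A -
          ((Real.sin (n * (2 * θ) - 2 * θ) : ℝ) : ℂ) • (1 : Matrix (Fin 2) (Fin 2) ℂ) := by
      intro n
      induction n with
      | zero => simp
      | succ n ih =>
        rw [pow_succ, ← smul_mul_assoc, ih, sub_mul, smul_mul_assoc, hquad, smul_mul_assoc,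
          one_mul, smul_sub, smul_smul]
        have e1 : (Real.sin (((n + 1 : ℕ) : ℝ) * (2 * θ)) : ℝ) =
            Real.sin (n * (2 * θ)) * (2 * Real.cos (2 * θ)) -
              Real.sin (n * (2 * θ) - 2 * θ) := by
          have e3 : ((n + 1 : ℕ) : ℝ) * (2 * θ) = n * (2 * θ) + 2 * θ := by
            push_cast
            ring
          rw [e3, Real.sin_add, Real.sin_sub]
          ring
        have e2 : ((n + 1 : ℕ) : ℝ) * (2 * θ) - 2 * θ = n * (2 * θ) := by
          push_cast
          ring
        rw [e2, e1]
        push_cast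
        module
    have hs : Real.sin (2 * θ) ≠ 0 := by
      apply ne_of_gt
      apply Real.sin_pos_of_pos_of_lt_pi
      · rw [hθ]
        positivity
      · have h2 : (2 * k : ℝ) < m := by exact_mod_cast hlt
        rw [hθ, ← mul_div_assoc, div_lt_iff₀ hm0]
        nlinarith [Real.pi_pos]
    have hmm : (m : ℝ) * (2 * θ) = k * (2 * Real.pi) := by linarith
    have h1 := hrec m
    have hs1 : Real.sin (k * (2 * Real.pi)) = 0 := by
      have := Real.sin_nat_mul_pi (2 * k)
      push_cast at this
      rw [← this]
      ring_nf
    have hs2 : Real.sin (k * (2 * Real.pi) - 2 * θ) = - Real.sin (2 * θ) := by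
      rw [Real.sin_nat_mul_two_pi_sub]
    rw [hmm, hs1, hs2] at h1
    have hsc : ((Real.sin (2 * θ) : ℝ) : ℂ) ≠ 0 := by exact_mod_cast hs
    apply smul_right_injective _ hsc
    simpa using h1

/-! ### The parameter sets -/

/-- A fixed choice of square roots of complex numbers, positive on positive reals. -/
structure SqrtChoice where
  root : ℂ → ℂ
  sq : ∀ z, root z ^ 2 = z
  pos : ∀ x : ℝ, 0 < x → root x = (Real.sqrt x : ℝ)

/-- Names of the representations of dihedral groups that occur as parameters: `rho k` is `ρ_k`,
`arrow r t` is `ϱ_r^t`, and `varrho z` is `ϱ_z`. -/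
inductive DihedralLabel (B : Type u) : Type u
  | rho (k : ℕ)
  | arrow (r t : B)
  | varrho (z : ℂ)

/-- The set of parameters for the pair `r`, `t` (`M r t = 0` stands for `m_{rt} = ∞`). -/
def paramSet {B : Type u} (M : CoxeterMatrix B) (r t : B) : Set (DihedralLabel B) :=
  if M r t = 0 then
    {DihedralLabel.arrow r t, DihedralLabel.arrow t r} ∪ Set.range DihedralLabel.varrho
  else
    {p | ∃ k : ℕ, 1 ≤ k ∧ 2 * k ≤ M r t ∧ p = DihedralLabel.rho k}

open Classical in
/-- The number `c` with `r · β_t = β_t + c β_r` in the representation of `⟨r, t⟩` named by the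
label, where `m` is the order of the product of the two generators. -/
noncomputable def DihedralLabel.coeff {B : Type u} (σ : SqrtChoice) (m : ℕ)
    (p : DihedralLabel B) (r t : B) : ℂ :=
  match p with
  | .rho k => (2 * Real.cos (k * Real.pi / m) : ℝ)
  | .arrow a b => if a = r ∧ b = t then 1 else 0
  | .varrho z => σ.root z

theorem DihedralLabel.coeff_pow {B : Type u} (σ : SqrtChoice) (M : CoxeterMatrix B) (r t : B)
    (p : DihedralLabel B) (hp : p ∈ paramSet M r t) :
    (dihedralGen (p.coeff σ (M r t) r t) (p.coeff σ (M r t) t r) 0 *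
      dihedralGen (p.coeff σ (M r t) r t) (p.coeff σ (M r t) t r) 1) ^ (M r t) = 1 := by
  by_cases h : M r t = 0
  · rw [h, pow_zero]
  · rw [paramSet, if_neg h] at hp
    obtain ⟨k, hk, hkm, rfl⟩ := hp
    exact dihedralGen_rho_pow (M r t) k hk hkm

/-- The representation of the dihedral group of order `2 m_{rt}` named by an element of the
parameter set of `r`, `t`; generator `0` is `r`, generator `1` is `t`. -/
noncomputable def DihedralLabel.rep {B : Type u} (σ : SqrtChoice) (M : CoxeterMatrix B) (r t : B)
    (h : r ≠ t) (p : DihedralLabel B) (hp : p ∈ paramSet M r t) :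
    Representation ℂ (dihedralMatrix (M r t) (M.off_diagonal r t h)).Group (Fin 2 → ℂ) :=
  dihedralRep (M r t) (M.off_diagonal r t h)
    (p.coeff σ (M r t) r t) (p.coeff σ (M r t) t r) (p.coeff_pow σ M r t hp)

/-- A family `(δ_{rt})_{r ≠ t}` with `δ_{rt} = δ_{tr}` in the parameter set of `r`, `t`. -/
structure LabelFamily {B : Type u} (M : CoxeterMatrix B) where
  δ : ∀ r t : B, r ≠ t → DihedralLabel B
  mem : ∀ (r t : B) (h : r ≠ t), δ r t h ∈ paramSet M r t
  symm : ∀ (r t : B) (h : r ≠ t), δ r t h = δ t r h.symm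

/-! ### The associated graph -/

open Classical in
/-- The number `m̃_{rt}` attached to a label, where `m` is `m_{rt}` (`0` stands for `∞`). In the
case of `ϱ_z` with `z = 4 cos² (kπ/n)`, `k` and `n` coprime, `1 ≤ k < n/2`, it is `n`. -/
noncomputable def DihedralLabel.reducedOrder {B : Type u} (m : ℕ) (p : DihedralLabel B) : ℕ :=
  match p with
  | .rho k => m / Nat.gcd m k
  | .arrow _ _ => 0
  | .varrho z =>
    if z = 0 then 2
    else if h : ∃ n k : ℕ, Nat.Coprime k n ∧ 1 ≤ k ∧ 2 * k < n ∧
        z = ((4 * Real.cos (k * Real.pi / n) ^ 2 : ℝ) : ℂ) then h.choose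
    else 0

theorem DihedralLabel.reducedOrder_ne_one {B : Type u} (M : CoxeterMatrix B) (r t : B)
    (p : DihedralLabel B) (hp : p ∈ paramSet M r t) : p.reducedOrder (M r t) ≠ 1 := by
  match p with
  | .rho k =>
    by_cases h : M r t = 0
    · simp [paramSet, h] at hp
    · rw [paramSet, if_neg h] at hp
      obtain ⟨k', hk, hkm, he⟩ := hp
      cases he
      intro h1
      have h2 : Nat.gcd (M r t) k ∣ M r t := Nat.gcd_dvd_left _ _
      have h3 : M r t = Nat.gcd (M r t) k := by
        have := Nat.div_mul_cancel h2
        simp only [DihedralLabel.reducedOrder] at h1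
        rw [h1, one_mul] at this
        exact this.symm
      have h4 : Nat.gcd (M r t) k ≤ k := Nat.gcd_le_right _ hk
      omega
  | .arrow _ _ => simp [DihedralLabel.reducedOrder]
  | .varrho z =>
    simp only [DihedralLabel.reducedOrder]
    split_ifs with h1 h2
    · norm_num
    · obtain ⟨k, _, hk, hkn, _⟩ := h2.choose_spec
      omega
    · norm_num

open Classical in
/-- The Coxeter matrix `(m̃_{rt})` of a family of labels. -/
noncomputable def LabelFamily.reducedMatrix {B : Type u} {M : CoxeterMatrix B}
    (F : LabelFamily M) : CoxeterMatrix B where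
  M := Matrix.of fun r t => if h : r = t then 1 else (F.δ r t h).reducedOrder (M r t)
  isSymm := by
    ext r t
    simp only [Matrix.transpose_apply, Matrix.of_apply]
    by_cases h : r = t
    · simp [h]
    · rw [dif_neg h, dif_neg (Ne.symm h), F.symm r t h, M.symmetric r t]
  diagonal r := by simp
  off_diagonal r t h := by
    rw [Matrix.of_apply, dif_neg h]
    exact DihedralLabel.reducedOrder_ne_one M r t _ (F.mem r t h)

/-- The Coxeter graph without its labels: `r`, `t` are joined if `3 ≤ m_{rt} ≤ ∞`. -/
def coxeterGraph {B : Type u} (M : CoxeterMatrix B) : SimpleGraph B where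
  Adj r t := M r t = 0 ∨ 3 ≤ M r t
  symm := ⟨fun r t h => by rwa [M.symmetric t r]⟩
  loopless := ⟨fun r h => by simp at h⟩

/-- The associated graph of a family of labels. -/
noncomputable def LabelFamily.graph {B : Type u} {M : CoxeterMatrix B} (F : LabelFamily M) :
    SimpleGraph B :=
  coxeterGraph F.reducedMatrix

/-! ### Integral homology of a graph -/

/-- The relations `(s, t) = -(t, s)` between oriented edges. -/
def orientationRelations {B : Type u} (G : SimpleGraph B) :
    AddSubgroup (FreeAbelianGroup G.Dart) :=
  AddSubgroup.closure
    (Set.range fun d : G.Dart => FreeAbelianGroup.of d + FreeAbelianGroup.of d.symm)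

/-- The group of `1`-chains, generated by the oriented edges. -/
abbrev GraphC1 {B : Type u} (G : SimpleGraph B) : Type u :=
  FreeAbelianGroup G.Dart ⧸ orientationRelations G

/-- A function on oriented edges that is odd under reversal extends to `1`-chains. -/
def GraphC1.lift {B : Type u} {G : SimpleGraph B} {A : Type*} [AddCommGroup A] (f : G.Dart → A)
    (hf : ∀ d : G.Dart, f d + f d.symm = 0) : GraphC1 G →+ A :=
  QuotientAddGroup.lift (orientationRelations G) (FreeAbelianGroup.lift f) (by
    rw [orientationRelations, AddSubgroup.closure_le]
    rintro _ ⟨d, rfl⟩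
    simpa using hf d)

/-- The boundary map `∂ (s, t) = t - s`. -/
def graphBoundary {B : Type u} (G : SimpleGraph B) : GraphC1 G →+ FreeAbelianGroup B :=
  GraphC1.lift (fun d => FreeAbelianGroup.of d.snd - FreeAbelianGroup.of d.fst) (by
    intro d
    simp)

/-- The first integral homology group. -/
abbrev GraphH1 {B : Type u} (G : SimpleGraph B) : AddSubgroup (GraphC1 G) :=
  (graphBoundary G).ker

/-! ### Data -/

/-- A family of labels with nonzero numbers `a r t = a_r^t`. -/
structure GGRDatum {B : Type u} (M : CoxeterMatrix B) where
  fam : LabelFamily M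
  a : ∀ r t : B, r ≠ t → ℂˣ

/-- The character `(r, t) ↦ a_t^r / a_r^t` of the group of `1`-chains of the associated graph. -/
noncomputable def GGRDatum.chainChar {B : Type u} {M : CoxeterMatrix B} (D : GGRDatum M) :
    GraphC1 D.fam.graph →+ Additive ℂˣ :=
  GraphC1.lift
    (fun d => Additive.ofMul (D.a d.snd d.fst d.adj.ne' / D.a d.fst d.snd d.adj.ne)) (by
    intro d
    rw [← ofMul_mul]
    simp)

/-- The associated character of the first homology group of the associated graph. -/
noncomputable def GGRDatum.assocChar {B : Type u} {M : CoxeterMatrix B} (D : GGRDatum M) :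
    AddChar (GraphH1 D.fam.graph) ℂˣ :=
  AddChar.toAddMonoidHomEquiv.symm (D.chainChar.comp (GraphH1 D.fam.graph).subtype)

/-- `ρ` is the representation defined by the datum: in some basis `(α_s)`, `r · α_r = -α_r`, and
`r · α_t = α_t + c (a_r^t / a_t^r) α_r` for `t ≠ r`, where `δ_{rt}(r) β_t = β_t + c β_r`. -/
def GGRDatum.Defines {B : Type u} {M : CoxeterMatrix B} (σ : SqrtChoice) (D : GGRDatum M)
    {W : Type w} [Group W] (cs : CoxeterSystem M W) {V : Type*} [AddCommGroup V] [Module ℂ V]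
    (ρ : Representation ℂ W V) : Prop :=
  ∃ α : Module.Basis B ℂ V, ∀ r : B, ρ (cs.simple r) (α r) = -α r ∧
    ∀ (t : B) (h : r ≠ t), ρ (cs.simple r) (α t) =
      α t + ((D.fam.δ r t h).coeff σ (M r t) r t *
        ((D.a r t h : ℂ) / (D.a t r h.symm : ℂ))) • α r

/-- The pairs `((δ_{rt}), χ)` with `χ` a character of the first homology group of the graph
associated with `(δ_{rt})`. -/
abbrev ClassificationData {B : Type u} (M : CoxeterMatrix B) : Type u :=
  Σ F : LabelFamily M, AddChar (GraphH1 F.graph) ℂˣ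

/-! ### Restriction to a dihedral subgroup -/

theorem dihedralHom_isLiftable {B : Type u} {M : CoxeterMatrix B} {W : Type w} [Group W]
    (cs : CoxeterSystem M W) (r t : B) (h : r ≠ t) :
    (dihedralMatrix (M r t) (M.off_diagonal r t h)).IsLiftable
      ![cs.simple r, cs.simple t] := by
  intro i j
  fin_cases i <;> fin_cases j
  · simp [dihedralMatrix]
  · simp [dihedralMatrix]
  · simp [dihedralMatrix]
  · simp [dihedralMatrix]

/-- The homomorphism from the dihedral group of order `2 m_{rt}` to the Coxeter group with image
`⟨r, t⟩`, sending `0` to `r` and `1` to `t`. -/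
noncomputable def dihedralHom {B : Type u} {M : CoxeterMatrix B} {W : Type w} [Group W]
    (cs : CoxeterSystem M W) (r t : B) (h : r ≠ t) :
    (dihedralMatrix (M r t) (M.off_diagonal r t h)).Group →* W :=
  (dihedralMatrix (M r t) (M.off_diagonal r t h)).toCoxeterSystem.lift
    ⟨![cs.simple r, cs.simple t], dihedralHom_isLiftable cs r t h⟩

/-- For all `r ≠ t`, the span of the reflection vectors of `r` and `t`, as a representation of the
dihedral group generated by `r` and `t`, is isomorphic to `δ_{rt}`. -/
def LabelFamily.IsLocalType {B : Type u} {M : CoxeterMatrix B} (σ : SqrtChoice)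
    (F : LabelFamily M) {W : Type w} [Group W] (cs : CoxeterSystem M W)
    {V : Type*} [AddCommGroup V] [Module ℂ V] (ρ : Representation ℂ W V) : Prop :=
  ∀ (r t : B) (h : r ≠ t),
    ∃ ψ : Representation.IntertwiningMap ((F.δ r t h).rep σ M r t h (F.mem r t h))
        (ρ.comp (dihedralHom cs r t h)),
      Function.Injective ψ ∧
      ∀ x y : V, IsReflectionVector (ρ (cs.simple r)) x →
        IsReflectionVector (ρ (cs.simple t)) y →
          LinearMap.range ψ.toLinearMap = Submodule.span ℂ {x, y}

/-! A reflection vector of `s` is unique up to a scalar, and `s` moves every vector by a multiple of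
it. A generalized geometric representation is therefore a family of numbers `x_rt` with `r α_t = α_t
+ x_rt α_r`, and an isomorphism can only rescale the `α_s`, replacing `x_rt` by `x_rt μ_r / μ_t`
(`GGRDatum.nonempty_equiv_iff`).

The relation for `r, t` constrains only the pair `(x_rt, x_tr)`. If `x_rt x_tr ≠ 4`, the space is
the sum of the plane of `α_r, α_t` and the common fixed space, so `(rt)^m = 1` can be tested on the
plane (`transvectionLike_mul_pow_eq_one`). There it reads `x_rt x_tr = 4 cos²(kπ/m)`, with both
numbers zero if the product is. Up to `(x, y) ↦ (xq, yq⁻¹)` the admissible pairs are listed once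
each by the labels (`exists_label`, `DihedralLabel.eq_of_coeff_eq`).

A representation thus amounts to labels together with units `q_rt = a_r^t / a_t^r`. The unit is
visible only where some coefficient is nonzero, that is, on the edges of the associated graph
(`LabelFamily.graph_adj_iff`). The units form a cochain with values in `ℂˣ`, and rescaling the basis
changes it by a coboundary. Since `ℂˣ` is divisible, hence injective, cochains modulo coboundaries
are exactly the characters of `H_1` (`GGRDatum.assocChar_eq_iff`, `exists_datum_of_character`). -/

/-! ### Reflections -/

section Reflection

variable {V : Type*} [AddCommGroup V] [Module ℂ V]

theorem IsReflectionVector.exists_apply_eq {f : Module.End ℂ V} {α : V}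
    (h : IsReflectionVector f α) (v : V) : ∃ c : ℂ, f v = v + c • α := by
  obtain ⟨hα, hf, H, hH, hfix⟩ := h
  have hmem : α ∉ H := fun hm => hα <| by
    have h1 : -α = α := hf.symm.trans (hfix α hm)
    have h2 : (2 : ℂ) • α = 0 := by rw [two_smul]; nth_rw 1 [← h1]; simp
    simpa using h2
  have hne : H.mkQ α ≠ 0 := by simpa using hmem
  obtain ⟨c, hc⟩ := exists_smul_eq_of_finrank_eq_one hH hne (H.mkQ v)
  have hv : v - c • α ∈ H := by
    rw [← Submodule.Quotient.mk_eq_zero, ← Submodule.mkQ_apply, map_sub, map_smul, hc, sub_self]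
  -- Write `v = h + cα` with `h ∈ H`; then `f v = h - cα = v - 2cα`.
  refine ⟨-(2 * c), ?_⟩
  have h3 := hfix _ hv
  rw [map_sub, map_smul, hf, sub_eq_iff_eq_add] at h3
  rw [h3]
  module

theorem IsReflectionVector.exists_eq_smul {f : Module.End ℂ V} {α v : V}
    (h : IsReflectionVector f α) (hv : f v = -v) : ∃ c : ℂ, v = c • α := by
  obtain ⟨c, hc⟩ := h.exists_apply_eq v
  refine ⟨-(c / 2), ?_⟩
  have h1 : (2 : ℂ) • v = (2 : ℂ) • (-(c / 2)) • α := by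
    rw [two_smul]
    nth_rw 1 [← neg_neg v]
    rw [← hv, hc]
    module
  exact smul_right_injective V two_ne_zero h1

theorem IsReflectionVector.span_singleton_eq {f : Module.End ℂ V} {α β : V}
    (hα : IsReflectionVector f α) (hβ : IsReflectionVector f β) :
    Submodule.span ℂ {β} = Submodule.span ℂ {α} := by
  obtain ⟨c, rfl⟩ := hα.exists_eq_smul hβ.2.1
  have hc : c ≠ 0 := by
    rintro rfl
    exact hβ.1 (zero_smul _ _)
  exact Submodule.span_singleton_smul_eq (IsUnit.mk0 c hc) α

/-- The linear map `v ↦ v + φ v • α`. -/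
def transvectionLike (φ : V →ₗ[ℂ] ℂ) (α : V) : Module.End ℂ V :=
  LinearMap.id + φ.smulRight α

theorem transvectionLike_apply (φ : V →ₗ[ℂ] ℂ) (α v : V) :
    transvectionLike φ α v = v + φ v • α := by
  simp [transvectionLike]

theorem isReflectionVector_transvectionLike {φ : V →ₗ[ℂ] ℂ} {α : V} (h : φ α = -2) :
    IsReflectionVector (transvectionLike φ α) α := by
  refine ⟨?_, ?_, LinearMap.ker φ, ?_, ?_⟩
  · rintro rfl
    simp at h
  · rw [transvectionLike_apply, h]
    module
  · have hs : Function.Surjective φ := fun c => ⟨(-c / 2) • α, by simp [h]⟩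
    rw [(φ.quotKerEquivOfSurjective hs).finrank_eq, Module.finrank_self]
  · intro x hx
    rw [transvectionLike_apply, LinearMap.mem_ker.1 hx, zero_smul, add_zero]

end Reflection

/-! ### Planes stable under two reflections -/

section Plane

variable {V : Type*} [AddCommGroup V] [Module ℂ V]

/-- The linear map `ℂ² → V` sending the standard basis to `a`, `b`. -/
noncomputable def planeMap (a b : V) : (Fin 2 → ℂ) →ₗ[ℂ] V :=
  Fintype.linearCombination ℂ ![a, b]

theorem planeMap_apply (a b : V) (v : Fin 2 → ℂ) : planeMap a b v = v 0 • a + v 1 • b := by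
  simp [planeMap, Fintype.linearCombination_apply, Fin.sum_univ_two]

theorem range_planeMap (a b : V) : LinearMap.range (planeMap a b) = Submodule.span ℂ {a, b} := by
  rw [planeMap, Fintype.range_linearCombination, Matrix.range_cons, Matrix.range_cons,
    Matrix.range_empty, Set.union_empty, Set.singleton_union]

theorem planeMap_injective {a b : V} (h : LinearIndependent ℂ ![a, b]) :
    Function.Injective (planeMap a b) := by
  rw [planeMap]
  exact linearIndependent_iff_injective_fintypeLinearCombination.1 h

theorem dihedralGen_zero_apply (x y : ℂ) (v : Fin 2 → ℂ) :
    dihedralGen x y 0 v = ![-v 0 + x * v 1, v 1] := by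
  ext i
  fin_cases i <;> simp [dihedralGen, Matrix.toLinAlgEquiv'_apply, Matrix.mulVec, dotProduct]

theorem dihedralGen_one_apply (x y : ℂ) (v : Fin 2 → ℂ) :
    dihedralGen x y 1 v = ![v 0, y * v 0 - v 1] := by
  ext i
  fin_cases i <;>
    simp [dihedralGen, Matrix.toLinAlgEquiv'_apply, Matrix.mulVec, dotProduct, sub_eq_add_neg]

theorem planeMap_dihedralGen_zero {f : Module.End ℂ V} {a b : V} {x : ℂ} (y : ℂ)
    (ha : f a = -a) (hb : f b = b + x • a) (v : Fin 2 → ℂ) :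
    planeMap a b (dihedralGen x y 0 v) = f (planeMap a b v) := by
  simp only [planeMap_apply, dihedralGen_zero_apply, map_add, map_smul, ha, hb,
    Matrix.cons_val_zero, Matrix.cons_val_one]
  module

theorem planeMap_dihedralGen_one {g : Module.End ℂ V} {a b : V} (x : ℂ) {y : ℂ}
    (hb : g b = -b) (ha : g a = a + y • b) (v : Fin 2 → ℂ) :
    planeMap a b (dihedralGen x y 1 v) = g (planeMap a b v) := by
  simp only [planeMap_apply, dihedralGen_one_apply, map_add, map_smul, ha, hb,
    Matrix.cons_val_zero, Matrix.cons_val_one]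
  module

theorem planeMap_dihedralGen_pow {f g : Module.End ℂ V} {a b : V} {x y : ℂ}
    (hfa : f a = -a) (hfb : f b = b + x • a) (hgb : g b = -b) (hga : g a = a + y • b)
    (n : ℕ) (v : Fin 2 → ℂ) :
    planeMap a b (((dihedralGen x y 0 * dihedralGen x y 1) ^ n) v) =
      ((f * g) ^ n) (planeMap a b v) := by
  induction n with
  | zero => simp
  | succ n ih =>
    rw [pow_succ', pow_succ', Module.End.mul_apply, Module.End.mul_apply, Module.End.mul_apply,
      Module.End.mul_apply, planeMap_dihedralGen_zero y hfa hfb,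
      planeMap_dihedralGen_one x hgb hga, ih]

/-- The plane embeds equivariantly in `V`, so a relation on `V` pulls back to the model. This is how
the Coxeter relations constrain the coefficients. -/
theorem dihedralGen_pow_eq_one {f g : Module.End ℂ V} {a b : V} {x y : ℂ}
    (hfa : f a = -a) (hfb : f b = b + x • a) (hgb : g b = -b) (hga : g a = a + y • b)
    (hab : LinearIndependent ℂ ![a, b]) {n : ℕ} (h : (f * g) ^ n = 1) :
    (dihedralGen x y 0 * dihedralGen x y 1) ^ n = 1 := by
  refine LinearMap.ext fun v => planeMap_injective hab ?_
  rw [planeMap_dihedralGen_pow hfa hfb hgb hga, h]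
  simp

/-- Two reflections whose Gram determinant is nonzero are determined by their action on the plane
spanned by the reflection vectors. -/
theorem transvectionLike_mul_pow_eq_one {φ ψ : V →ₗ[ℂ] ℂ} {a b : V}
    (ha : φ a = -2) (hb : ψ b = -2) (hdet : φ b * ψ a ≠ 4) {n : ℕ}
    (h : (dihedralGen (φ b) (ψ a) 0 * dihedralGen (φ b) (ψ a) 1) ^ n = 1) :
    (transvectionLike φ a * transvectionLike ψ b) ^ n = 1 := by
  have hd : 4 - φ b * ψ a ≠ 0 := sub_ne_zero.2 hdet.symm
  refine LinearMap.ext fun v => ?_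
  -- Cramer's rule for the vector `p a + q b` on which `φ` and `ψ` take the same values as on `v`;
  -- the remainder `z` is then fixed by both reflections.
  set p : ℂ := -(2 * φ v + φ b * ψ v) / (4 - φ b * ψ a) with hp
  set q : ℂ := -(2 * ψ v + ψ a * φ v) / (4 - φ b * ψ a) with hq
  set z : V := v - (p • a + q • b) with hz
  have hφz : φ z = 0 := by
    simp only [hz, map_sub, map_add, map_smul, ha, smul_eq_mul]
    rw [hp, hq]
    field_simp
    ring
  have hψz : ψ z = 0 := by
    simp only [hz, map_sub, map_add, map_smul, hb, smul_eq_mul]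
    rw [hp, hq]
    field_simp
    ring
  have hfix : ∀ k : ℕ, ((transvectionLike φ a * transvectionLike ψ b) ^ k) z = z := by
    intro k
    induction k with
    | zero => simp
    | succ k ih =>
      rw [pow_succ', Module.End.mul_apply, ih, Module.End.mul_apply, transvectionLike_apply ψ, hψz,
        zero_smul, add_zero, transvectionLike_apply, hφz, zero_smul, add_zero]
  have hplane : ((transvectionLike φ a * transvectionLike ψ b) ^ n) (planeMap a b ![p, q]) =
      planeMap a b ![p, q] := by
    rw [← planeMap_dihedralGen_pow (isReflectionVector_transvectionLike ha).2.1
      (transvectionLike_apply φ a b) (isReflectionVector_transvectionLike hb).2.1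
      (transvectionLike_apply ψ b a), h]
    simp
  have hv : v = z + planeMap a b ![p, q] := by
    rw [planeMap_apply]
    simp [hz]
  rw [Module.End.one_apply]
  nth_rw 1 [hv]
  rw [map_add, hfix, hplane, ← hv]

end Plane

/-! ### Parameters of two-dimensional representations of dihedral groups -/

theorem dihedralGen_mul_apply (x y : ℂ) (v : Fin 2 → ℂ) :
    (dihedralGen x y 0 * dihedralGen x y 1) v =
      ![(x * y - 1) * v 0 - x * v 1, y * v 0 - v 1] := by
  rw [Module.End.mul_apply, dihedralGen_one_apply, dihedralGen_zero_apply]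
  ext i
  fin_cases i
  · simp
    ring
  · simp

/-- The product of the generators is `-(1 + N)` with `N² = -xy = 0`, so its `n`-th power is `(-1)^n
(1 + nN)`. -/
theorem dihedralGen_pow_apply_of_mul_eq_zero {x y : ℂ} (h : x * y = 0) (n : ℕ) (v : Fin 2 → ℂ) :
    ((dihedralGen x y 0 * dihedralGen x y 1) ^ n) v =
      ![(-1) ^ n * (v 0 + n * x * v 1), (-1) ^ n * (v 1 - n * y * v 0)] := by
  induction n with
  | zero => ext i; fin_cases i <;> simp
  | succ n ih =>
    rw [pow_succ', Module.End.mul_apply, ih, dihedralGen_mul_apply]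
    ext i
    fin_cases i
    · simp
      linear_combination ((-1) ^ n * (v 0 + n * v 0 + n * x * v 1)) * h
    · simp
      linear_combination ((-1) ^ n * n * v 1) * h

/-- Here the product is `1 + N` with `N² = 4 - xy = 0`. As `N ≠ 0`, it has infinite order, which
excludes `xy = 4` for finite `m`. -/
theorem dihedralGen_pow_apply_of_mul_eq_four {x y : ℂ} (h : x * y = 4) (n : ℕ) (v : Fin 2 → ℂ) :
    ((dihedralGen x y 0 * dihedralGen x y 1) ^ n) v =
      ![v 0 + n * (2 * v 0 - x * v 1), v 1 + n * (y * v 0 - 2 * v 1)] := by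
  induction n with
  | zero => ext i; fin_cases i <;> simp
  | succ n ih =>
    rw [pow_succ', Module.End.mul_apply, ih, dihedralGen_mul_apply]
    ext i
    fin_cases i
    · simp
      linear_combination (v 0 + n * v 0 - n * x * v 1) * h
    · simp
      linear_combination (-(n * v 1)) * h

theorem dihedralGen_pow_eq_one_of_mul_eq_zero {x y : ℂ} (h : x * y = 0) {m : ℕ} (hm : m ≠ 0)
    (hpow : (dihedralGen x y 0 * dihedralGen x y 1) ^ m = 1) : x = 0 ∧ y = 0 ∧ Even m := by
  have hm' : (m : ℂ) ≠ 0 := by exact_mod_cast hm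
  have h1 := dihedralGen_pow_apply_of_mul_eq_zero h m ![1, 0]
  have h2 := dihedralGen_pow_apply_of_mul_eq_zero h m ![0, 1]
  rw [hpow, Module.End.one_apply] at h1 h2
  have h10 := congrFun h1 0
  have h11 := congrFun h1 1
  have h20 := congrFun h2 0
  simp [hm'] at h10 h11 h20
  refine ⟨h20, h11, ?_⟩
  by_contra hodd
  rw [Nat.not_even_iff_odd] at hodd
  rw [hodd.neg_one_pow] at h10
  norm_num at h10

theorem mul_ne_four_of_dihedralGen_pow_eq_one {x y : ℂ} {m : ℕ} (hm : m ≠ 0)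
    (hpow : (dihedralGen x y 0 * dihedralGen x y 1) ^ m = 1) : x * y ≠ 4 := by
  intro h
  have hm' : (m : ℂ) ≠ 0 := by exact_mod_cast hm
  have h1 := dihedralGen_pow_apply_of_mul_eq_four h m ![1, 0]
  rw [hpow, Module.End.one_apply] at h1
  have h10 := congrFun h1 0
  simp [hm'] at h10

/-- `l` is an eigenvalue of the product, whose determinant is `1` and whose trace is `xy - 2`; the
quadratic relation is its characteristic equation. -/
theorem exists_pow_eq_one_of_dihedralGen_pow_eq_one {x y : ℂ} (h : x * y ≠ 0) {m : ℕ}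
    (hpow : (dihedralGen x y 0 * dihedralGen x y 1) ^ m = 1) :
    ∃ l : ℂ, l ^ m = 1 ∧ l * (x * y) = (l + 1) ^ 2 := by
  obtain ⟨s, hs⟩ := IsAlgClosed.exists_pow_nat_eq ((x * y - 2) ^ 2 - 4) two_pos
  set l : ℂ := (x * y - 2 + s) / 2 with hl
  have hquad : l * (x * y) = (l + 1) ^ 2 := by
    rw [hl]
    linear_combination -(1 / 4) * hs
  refine ⟨l, ?_, hquad⟩
  have hy : y ≠ 0 := right_ne_zero_of_mul h
  -- `(1 + l, y)` is an eigenvector for `l`, nonzero because `y ≠ 0`.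
  have heig : ∀ n : ℕ, ((dihedralGen x y 0 * dihedralGen x y 1) ^ n) ![1 + l, y] =
      l ^ n • ![1 + l, y] := by
    intro n
    induction n with
    | zero => simp
    | succ n ih =>
      rw [pow_succ', Module.End.mul_apply, ih, map_smul, dihedralGen_mul_apply, pow_succ, mul_smul]
      congr 1
      ext i
      fin_cases i
      · simp
        linear_combination hquad
      · simp
        ring
  have h1 := congrFun (heig m) 1
  rw [hpow] at h1
  simpa [hy] using h1.symm

theorem cos_sq_eq_of_add_eq {m j k : ℕ} (h : j + k = m) :
    Real.cos (j * Real.pi / m) ^ 2 = Real.cos (k * Real.pi / m) ^ 2 := by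
  rcases Nat.eq_zero_or_pos m with rfl | hm
  · simp
  have hm' : (m : ℝ) ≠ 0 := by positivity
  have : (j : ℝ) * Real.pi / m = Real.pi - k * Real.pi / m := by
    rw [← h] at hm' ⊢
    push_cast at hm' ⊢
    field_simp
    ring
  rw [this, Real.cos_pi_sub, neg_sq]

/-- With `l = e²` and `e = exp(ijπ/m)`, the equation gives `xy = (e + e⁻¹)² = (2 cos(jπ/m))²`. The
value `j = 0` would give `xy = 4`, and `j > m/2` is reflected to `m - j`. -/
theorem exists_mul_eq_four_mul_cos_sq {x y : ℂ} (h : x * y ≠ 0) {m : ℕ} (hm : m ≠ 0)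
    (hpow : (dihedralGen x y 0 * dihedralGen x y 1) ^ m = 1) :
    ∃ k : ℕ, 1 ≤ k ∧ 2 * k ≤ m ∧ x * y = ((2 * Real.cos (k * Real.pi / m) : ℝ) : ℂ) ^ 2 := by
  obtain ⟨l, hlm, hl⟩ := exists_pow_eq_one_of_dihedralGen_pow_eq_one h hpow
  have hm' : (m : ℂ) ≠ 0 := by exact_mod_cast hm
  have : NeZero m := ⟨hm⟩
  obtain ⟨j, hj, rfl⟩ := (Complex.isPrimitiveRoot_exp m hm).eq_pow_of_pow_eq_one hlm
  have hxy : x * y = ((2 * Real.cos (j * Real.pi / m) : ℝ) : ℂ) ^ 2 := by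
    set e : ℂ := Complex.exp ((j * Real.pi / m : ℂ) * Complex.I) with he
    have hee : Complex.exp (2 * Real.pi * Complex.I / m) ^ j = e ^ 2 := by
      rw [he, ← Complex.exp_nat_mul, ← Complex.exp_nat_mul]
      congr 1
      push_cast
      ring
    have he0 : e ≠ 0 := Complex.exp_ne_zero _
    have hcos : ((2 * Real.cos (j * Real.pi / m) : ℝ) : ℂ) = e + e⁻¹ := by
      push_cast
      rw [Complex.two_cos, he, ← Complex.exp_neg, neg_mul]
    rw [hee] at hl
    rw [hcos]
    field_simp
    linear_combination hl
  have hj0 : j ≠ 0 := by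
    rintro rfl
    apply mul_ne_four_of_dihedralGen_pow_eq_one hm hpow
    rw [hxy]
    norm_num
  by_cases hle : 2 * j ≤ m
  · exact ⟨j, Nat.one_le_iff_ne_zero.2 hj0, hle, hxy⟩
  · refine ⟨m - j, by omega, by omega, ?_⟩
    rw [hxy]
    have h2 := cos_sq_eq_of_add_eq (m := m) (j := j) (k := m - j) (by omega)
    rw [← Complex.ofReal_pow, ← Complex.ofReal_pow, mul_pow, mul_pow, h2]

theorem exists_eq_mul_unit {x y c d : ℂ} (h : x * y = c * d) (hc : c ≠ 0) (hd : d ≠ 0) :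
    ∃ q : ℂˣ, x = c * q ∧ y = d * (q⁻¹ : ℂˣ) := by
  have hx : x ≠ 0 := left_ne_zero_of_mul (h ▸ mul_ne_zero hc hd)
  refine ⟨Units.mk0 (x / c) (div_ne_zero hx hc), ?_, ?_⟩
  · simp
    field_simp
  · simp
    field_simp
    linear_combination h

/-! ### Labels and their coefficients -/

section Label

variable {B : Type u}

theorem paramSet_comm (M : CoxeterMatrix B) (r t : B) : paramSet M r t = paramSet M t r := by
  rw [paramSet, paramSet, M.symmetric r t, Set.pair_comm]

theorem SqrtChoice.root_zero (σ : SqrtChoice) : σ.root 0 = 0 := by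
  simpa using σ.sq 0

theorem SqrtChoice.root_ne_zero (σ : SqrtChoice) {z : ℂ} (hz : z ≠ 0) : σ.root z ≠ 0 := by
  intro h
  apply hz
  rw [← σ.sq z, h]
  simp

theorem DihedralLabel.coeff_arrow_self (σ : SqrtChoice) (m : ℕ) (r t : B) :
    (DihedralLabel.arrow r t).coeff σ m r t = 1 := by
  simp [DihedralLabel.coeff]

theorem DihedralLabel.coeff_arrow_swap (σ : SqrtChoice) (m : ℕ) {r t : B} (h : r ≠ t) :
    (DihedralLabel.arrow t r).coeff σ m r t = 0 := by
  simp [DihedralLabel.coeff, h.symm]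

theorem DihedralLabel.coeff_varrho (σ : SqrtChoice) (m : ℕ) (z : ℂ) (r t : B) :
    (DihedralLabel.varrho z : DihedralLabel B).coeff σ m r t = σ.root z := rfl

theorem DihedralLabel.coeff_rho (σ : SqrtChoice) (m k : ℕ) (r t : B) :
    (DihedralLabel.rho k : DihedralLabel B).coeff σ m r t =
      ((2 * Real.cos (k * Real.pi / m) : ℝ) : ℂ) := rfl

theorem mem_paramSet_of_eq_zero {M : CoxeterMatrix B} {r t : B} (h : M r t = 0)
    {p : DihedralLabel B} :
    p ∈ paramSet M r t ↔
      p = .arrow r t ∨ p = .arrow t r ∨ ∃ z, p = .varrho z := by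
  rw [paramSet, if_pos h]
  simp [or_assoc, eq_comm]

theorem mem_paramSet_of_ne_zero {M : CoxeterMatrix B} {r t : B} (h : M r t ≠ 0)
    {p : DihedralLabel B} :
    p ∈ paramSet M r t ↔ ∃ k : ℕ, 1 ≤ k ∧ 2 * k ≤ M r t ∧ p = .rho k := by
  rw [paramSet, if_neg h]
  rfl

/-- Every two-dimensional action of a dihedral group by reflections with independent reflection
vectors is a rescaling of one named by a label. -/
theorem exists_label (σ : SqrtChoice) (M : CoxeterMatrix B) {r t : B} (hrt : r ≠ t) {x y : ℂ}
    (h : (dihedralGen x y 0 * dihedralGen x y 1) ^ (M r t) = 1) :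
    ∃ p ∈ paramSet M r t, ∃ q : ℂˣ, x = p.coeff σ (M r t) r t * q ∧
      y = p.coeff σ (M r t) t r * (q⁻¹ : ℂˣ) := by
  by_cases hm : M r t = 0
  -- No relation is imposed, so all orbits of `(x, y) ↦ (xq, yq⁻¹)` occur: the origin, the two
  -- punctured axes, and the hyperbolas `xy = z` with `z ≠ 0`.
  · by_cases hxy : x * y = 0
    · by_cases hx : x = 0
      · by_cases hy : y = 0
        · refine ⟨.varrho 0, (mem_paramSet_of_eq_zero hm).2 (Or.inr (Or.inr ⟨0, rfl⟩)), 1, ?_, ?_⟩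
          · rw [DihedralLabel.coeff_varrho, σ.root_zero, hx, zero_mul]
          · rw [DihedralLabel.coeff_varrho, σ.root_zero, hy, zero_mul]
        · refine ⟨.arrow t r, (mem_paramSet_of_eq_zero hm).2 (Or.inr (Or.inl rfl)),
            (Units.mk0 y hy)⁻¹, ?_, ?_⟩
          · rw [DihedralLabel.coeff_arrow_swap σ _ hrt, hx, zero_mul]
          · rw [DihedralLabel.coeff_arrow_self, inv_inv, one_mul, Units.val_mk0]
      · have hy : y = 0 := (mul_eq_zero.1 hxy).resolve_left hx
        refine ⟨.arrow r t, (mem_paramSet_of_eq_zero hm).2 (Or.inl rfl), Units.mk0 x hx, ?_, ?_⟩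
        · rw [DihedralLabel.coeff_arrow_self, one_mul, Units.val_mk0]
        · rw [DihedralLabel.coeff_arrow_swap σ _ hrt.symm, hy, zero_mul]
    · refine ⟨.varrho (x * y), (mem_paramSet_of_eq_zero hm).2 (Or.inr (Or.inr ⟨_, rfl⟩)), ?_⟩
      exact exists_eq_mul_unit (by rw [DihedralLabel.coeff_varrho, DihedralLabel.coeff_varrho,
        ← sq, σ.sq]) (σ.root_ne_zero hxy) (σ.root_ne_zero hxy)
  · by_cases hxy : x * y = 0
    -- Both coefficients vanish and `m = k + k`, so the label is `ρ_{m/2}`, with `cos(π/2) = 0`.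
    · obtain ⟨hx, hy, k, hk⟩ := dihedralGen_pow_eq_one_of_mul_eq_zero hxy hm h
      have hc : Real.cos (k * Real.pi / M r t) = 0 := by
        have hk0 : (k : ℝ) ≠ 0 := by
          have : k ≠ 0 := by omega
          exact_mod_cast this
        rw [← Real.cos_pi_div_two, hk]
        congr 1
        push_cast
        field_simp
        ring
      refine ⟨.rho k, (mem_paramSet_of_ne_zero hm).2 ⟨k, by omega, by omega, rfl⟩, 1, ?_, ?_⟩ <;>
      simp [DihedralLabel.coeff_rho, hc, hx, hy]
    · obtain ⟨k, hk, hkm, he⟩ := exists_mul_eq_four_mul_cos_sq hxy hm h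
      refine ⟨.rho k, (mem_paramSet_of_ne_zero hm).2 ⟨k, hk, hkm, rfl⟩, ?_⟩
      have hne : ((2 * Real.cos (k * Real.pi / M r t) : ℝ) : ℂ) ≠ 0 := by
        intro h0
        rw [h0] at he
        exact hxy (by simpa using he)
      exact exists_eq_mul_unit (he.trans (sq _)) hne hne

theorem mul_pi_div_mem_Icc {m k : ℕ} (h : 2 * k ≤ m) (hm : m ≠ 0) :
    (k * Real.pi / m : ℝ) ∈ Set.Icc 0 (Real.pi / 2) := by
  have hm' : (0 : ℝ) < m := by positivity
  have h' : (2 * k : ℝ) ≤ m := by exact_mod_cast h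
  refine ⟨by positivity, ?_⟩
  rw [div_le_div_iff₀ hm' two_pos]
  nlinarith [Real.pi_pos]

theorem cos_mul_pi_div_eq_zero_iff {m k : ℕ} (h : 2 * k ≤ m) (hm : m ≠ 0) :
    Real.cos (k * Real.pi / m) = 0 ↔ 2 * k = m := by
  have hm' : (m : ℝ) ≠ 0 := by positivity
  have hI := mul_pi_div_mem_Icc h hm
  rw [← Real.cos_pi_div_two, Real.injOn_cos.eq_iff ⟨hI.1, by linarith [hI.2, Real.pi_pos]⟩
    ⟨by positivity, by linarith [Real.pi_pos]⟩, div_eq_div_iff hm' two_ne_zero]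
  rw [← @Nat.cast_inj ℝ]
  push_cast
  constructor
  · intro h1
    have : Real.pi * (2 * k - m) = 0 := by linarith
    linarith [(mul_eq_zero.1 this).resolve_left Real.pi_ne_zero]
  · intro h1
    rw [← h1]
    ring

/-- The angles lie in `[0, π/2]`, where cosine is nonnegative and injective, so even its square
determines `k`. -/
theorem eq_of_cos_sq_eq {m k l : ℕ} (hk : 2 * k ≤ m) (hl : 2 * l ≤ m) (hm : m ≠ 0)
    (h : Real.cos (k * Real.pi / m) ^ 2 = Real.cos (l * Real.pi / m) ^ 2) : k = l := by
  have hm' : (m : ℝ) ≠ 0 := by positivity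
  have hkI := mul_pi_div_mem_Icc hk hm
  have hlI := mul_pi_div_mem_Icc hl hm
  have hcos := (pow_left_inj₀
    (Real.cos_nonneg_of_mem_Icc ⟨by linarith [hkI.1, Real.pi_pos], hkI.2⟩)
    (Real.cos_nonneg_of_mem_Icc ⟨by linarith [hlI.1, Real.pi_pos], hlI.2⟩) two_ne_zero).1 h
  have := Real.injOn_cos ⟨hkI.1, by linarith [hkI.2, Real.pi_pos]⟩
    ⟨hlI.1, by linarith [hlI.2, Real.pi_pos]⟩ hcos
  rw [div_left_inj' hm', mul_left_inj' Real.pi_ne_zero] at this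
  exact_mod_cast this

/-- A label is determined by its coefficients up to rescaling of the basis. -/
theorem DihedralLabel.eq_of_coeff_eq (σ : SqrtChoice) {M : CoxeterMatrix B} {r t : B}
    (hrt : r ≠ t) {p p' : DihedralLabel B} (hp : p ∈ paramSet M r t) (hp' : p' ∈ paramSet M r t)
    {q : ℂˣ} (h : p'.coeff σ (M r t) r t = p.coeff σ (M r t) r t * q)
    (h' : p'.coeff σ (M r t) t r = p.coeff σ (M r t) t r * (q⁻¹ : ℂˣ)) : p = p' := by
  -- The product of the two coefficients does not change under rescaling. It separates all labels
  -- except the two arrows and `ϱ_0`, which differ in which coefficients vanish.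
  have hmul : p'.coeff σ (M r t) r t * p'.coeff σ (M r t) t r =
      p.coeff σ (M r t) r t * p.coeff σ (M r t) t r := by
    rw [h, h', mul_mul_mul_comm, Units.mul_inv, mul_one]
  by_cases hm : M r t = 0
  · rw [mem_paramSet_of_eq_zero hm] at hp hp'
    have hq : (q : ℂ) ≠ 0 := q.ne_zero
    rcases hp with rfl | rfl | ⟨z, rfl⟩ <;> rcases hp' with rfl | rfl | ⟨z', rfl⟩ <;>
      simp only [coeff_arrow_self, coeff_arrow_swap σ _ hrt, coeff_arrow_swap σ _ hrt.symm,
        coeff_varrho] at h h' hmul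
    · rfl
    · simp at h'
    · rw [h] at h'
      simp at h'
    · simp at h
    · rfl
    · rw [h] at h'
      exact absurd (by simpa using h') hq.symm
    · rw [← sq, σ.sq] at hmul
      simp only [mul_zero] at hmul
      rw [← hmul, σ.root_zero] at h
      simp at h
    · rw [← sq, σ.sq] at hmul
      simp only [zero_mul] at hmul
      rw [← hmul, σ.root_zero] at h'
      simp at h'
    · rw [← sq, ← sq, σ.sq, σ.sq] at hmul
      rw [hmul]
  · rw [mem_paramSet_of_ne_zero hm] at hp hp'
    obtain ⟨k, hk, hkm, rfl⟩ := hp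
    obtain ⟨k', hk', hkm', rfl⟩ := hp'
    simp only [coeff_rho] at hmul
    norm_cast at hmul
    rw [eq_of_cos_sq_eq hkm hkm' hm (by nlinarith)]

theorem DihedralLabel.reducedOrder_eq_two_iff (σ : SqrtChoice) {M : CoxeterMatrix B} {r t : B}
    {p : DihedralLabel B} (hp : p ∈ paramSet M r t) :
    p.reducedOrder (M r t) = 2 ↔
      p.coeff σ (M r t) r t = 0 ∧ p.coeff σ (M r t) t r = 0 := by
  by_cases hm : M r t = 0
  · rw [mem_paramSet_of_eq_zero hm] at hp
    rcases hp with rfl | rfl | ⟨z, rfl⟩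
    · simp [coeff_arrow_self, reducedOrder]
    · simp [coeff_arrow_self, reducedOrder]
    · simp only [coeff_varrho, reducedOrder, and_self]
      by_cases hz : z = 0
      · simp [hz, σ.root_zero]
      · rw [if_neg hz]
        simp only [σ.root_ne_zero hz, iff_false]
        split_ifs with h
        -- Whichever `n` was chosen, `1 ≤ k` and `2k < n` force `n ≥ 3`.
        · obtain ⟨k, _, hk, hkn, _⟩ := h.choose_spec
          omega
        · norm_num
  · rw [mem_paramSet_of_ne_zero hm] at hp
    obtain ⟨k, hk, hkm, rfl⟩ := hp
    simp only [coeff_rho, reducedOrder, and_self]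
    norm_cast
    rw [mul_eq_zero, or_iff_right two_ne_zero, cos_mul_pi_div_eq_zero_iff hkm hm]
    constructor
    · intro h
      -- `m = 2 gcd(m, k) ≤ 2k ≤ m`, so equality holds throughout.
      have h1 := Nat.div_mul_cancel (Nat.gcd_dvd_left (M r t) k)
      have h2 := Nat.gcd_le_right (M r t) hk
      rw [h] at h1
      omega
    · intro h
      rw [← h, Nat.gcd_eq_right (Dvd.intro_left _ rfl)]
      exact Nat.mul_div_cancel _ hk

/-- The reduced order is never `1`, so a missing edge means order `2`, that is, both coefficients
zero. -/
theorem LabelFamily.graph_adj_iff (σ : SqrtChoice) {M : CoxeterMatrix B} (F : LabelFamily M)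
    {r t : B} (h : r ≠ t) :
    F.graph.Adj r t ↔ (F.δ r t h).coeff σ (M r t) r t ≠ 0 ∨
      (F.δ r t h).coeff σ (M r t) t r ≠ 0 := by
  rw [← not_and_or, ← DihedralLabel.reducedOrder_eq_two_iff σ (F.mem r t h)]
  have h1 := DihedralLabel.reducedOrder_ne_one M r t _ (F.mem r t h)
  have h2 : F.reducedMatrix r t = (F.δ r t h).reducedOrder (M r t) := by
    simp [LabelFamily.reducedMatrix, h]
  change (F.reducedMatrix r t = 0 ∨ 3 ≤ F.reducedMatrix r t) ↔ _
  rw [h2]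
  omega

theorem DihedralLabel.coeff_mul_coeff_ne_four (σ : SqrtChoice) {M : CoxeterMatrix B} {r t : B}
    (hm : M r t ≠ 0) {p : DihedralLabel B} (hp : p ∈ paramSet M r t) :
    p.coeff σ (M r t) r t * p.coeff σ (M r t) t r ≠ 4 :=
  mul_ne_four_of_dihedralGen_pow_eq_one hm (p.coeff_pow σ M r t hp)

end Label

/-! ### Characters with values in a divisible group -/

/-- The exponential is a surjective homomorphism from the divisible group `ℂ`. -/
noncomputable instance Complex.divisibleByAdditiveUnits : DivisibleBy (Additive ℂˣ) ℤ :=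
  Function.Surjective.divisibleBy
    (fun z : ℂ => Additive.ofMul (Units.mk0 (Complex.exp z) (Complex.exp_ne_zero z)))
    (fun a => ⟨Complex.log (a.toMul : ℂ), by
      apply Additive.toMul.injective
      ext
      simp [Complex.exp_log]⟩)
    (fun z n => by
      apply Additive.toMul.injective
      ext
      simp [Complex.exp_int_mul])

/-- `g` descends to `G / ker f`, which embeds in `H`; divisible groups are injective, so the
descended map extends to `H`. -/
theorem AddMonoidHom.exists_comp_eq_of_ker_le {G H A : Type*} [AddCommGroup G] [AddCommGroup H]
    [AddCommGroup A] [DivisibleBy A ℤ] (f : G →+ H) (g : G →+ A) (h : f.ker ≤ g.ker) :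
    ∃ k : H →+ A, k.comp f = g := by
  obtain ⟨k, hk⟩ := (Module.Baer.of_divisible A).extension_property_addMonoidHom
    (QuotientAddGroup.kerLift f) (QuotientAddGroup.kerLift_injective f)
    (QuotientAddGroup.lift f.ker g h)
  refine ⟨k, ?_⟩
  ext x
  exact DFunLike.congr_fun hk (QuotientAddGroup.mk x)

/-! ### Chains of a graph -/

section Chain

variable {B : Type u} {G : SimpleGraph B} {A : Type*} [AddCommGroup A]

/-- The `1`-chain of an oriented edge. -/
def GraphC1.dart (d : G.Dart) : GraphC1 G := QuotientAddGroup.mk (FreeAbelianGroup.of d)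

@[simp]
theorem GraphC1.lift_dart (f : G.Dart → A) (hf : ∀ d : G.Dart, f d + f d.symm = 0) (d : G.Dart) :
    GraphC1.lift f hf (GraphC1.dart d) = f d := by
  simp [GraphC1.lift, GraphC1.dart]

theorem GraphC1.hom_ext {f g : GraphC1 G →+ A}
    (h : ∀ d : G.Dart, f (GraphC1.dart d) = g (GraphC1.dart d)) : f = g := by
  refine QuotientAddGroup.addMonoidHom_ext _ (FreeAbelianGroup.lift_ext _ _ ?_)
  exact h

theorem GraphC1.dart_symm (d : G.Dart) : GraphC1.dart d.symm = -GraphC1.dart d := by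
  rw [eq_neg_iff_add_eq_zero, add_comm]
  exact (QuotientAddGroup.eq_zero_iff _).2 (AddSubgroup.subset_closure ⟨d, rfl⟩)

end Chain

/-! ### The representation defined by a datum -/

theorem IsReflectionVector.of_apply_eq_neg {V : Type*} [AddCommGroup V] [Module ℂ V]
    {f : Module.End ℂ V} {α β : V} (h : IsReflectionVector f α) (hβ : β ≠ 0) (hf : f β = -β) :
    IsReflectionVector f β :=
  ⟨hβ, hf, h.2.2⟩

/-- In the basis `q⁻¹β₀, β₁` the same operators have parameters `xq, yq⁻¹`. -/
theorem dihedralGen_rescale_pow_eq_one {x y : ℂ} {n : ℕ}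
    (h : (dihedralGen x y 0 * dihedralGen x y 1) ^ n = 1) (q : ℂˣ) :
    (dihedralGen (x * q) (y * (q⁻¹ : ℂˣ)) 0 * dihedralGen (x * q) (y * (q⁻¹ : ℂˣ)) 1) ^ n = 1 := by
  refine dihedralGen_pow_eq_one (f := dihedralGen x y 0) (g := dihedralGen x y 1)
    (a := ![((q⁻¹ : ℂˣ) : ℂ), 0]) (b := ![0, 1]) ?_ ?_ ?_ ?_ ?_ h
  · rw [dihedralGen_zero_apply]
    simp
  · rw [dihedralGen_zero_apply]
    simp
  · rw [dihedralGen_one_apply]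
    simp
  · rw [dihedralGen_one_apply]
    simp
  · rw [LinearIndependent.pair_iff]
    intro s t hst
    simpa using hst

theorem transvectionLike_mul_self {V : Type*} [AddCommGroup V] [Module ℂ V] {φ : V →ₗ[ℂ] ℂ}
    {α : V} (h : φ α = -2) : transvectionLike φ α * transvectionLike φ α = 1 := by
  ext v
  rw [Module.End.mul_apply, transvectionLike_apply, transvectionLike_apply, map_add, map_smul, h,
    smul_eq_mul, Module.End.one_apply]
  module

theorem CoxeterSystem.map_apply_of_map_simple {B : Type u} {M : CoxeterMatrix B} {W : Type w}
    [Group W] (cs : CoxeterSystem M W) {V V' : Type*} [AddCommGroup V] [Module ℂ V]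
    [AddCommGroup V'] [Module ℂ V'] {ρ : Representation ℂ W V} {τ : Representation ℂ W V'}
    {f : V →ₗ[ℂ] V'} (h : ∀ s v, f (ρ (cs.simple s) v) = τ (cs.simple s) (f v)) (g : W) :
    ∀ v, f (ρ g v) = τ g (f v) := by
  induction g using cs.simple_induction with
  | simple s => exact h s
  | one => simp
  | mul g g' hg hg' =>
    intro v
    rw [map_mul, map_mul, Module.End.mul_apply, Module.End.mul_apply, hg, hg']

section Datum

variable {B : Type u} {M : CoxeterMatrix B}

/-- The number `x` with `r · α_t = α_t + x α_r` in the representation defined by the datum. -/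
noncomputable def GGRDatum.coeff (σ : SqrtChoice) (D : GGRDatum M) (r t : B) (h : r ≠ t) : ℂ :=
  (D.fam.δ r t h).coeff σ (M r t) r t * ((D.a r t h / D.a t r h.symm : ℂˣ) : ℂ)

theorem GGRDatum.coeff_swap (σ : SqrtChoice) (D : GGRDatum M) {r t : B} (h : r ≠ t) :
    D.coeff σ t r h.symm = (D.fam.δ r t h).coeff σ (M r t) t r *
      (((D.a r t h / D.a t r h.symm)⁻¹ : ℂˣ) : ℂ) := by
  rw [GGRDatum.coeff, D.fam.symm t r, M.symmetric t r, inv_div]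

theorem GGRDatum.defines_iff (σ : SqrtChoice) (D : GGRDatum M) {W : Type w} [Group W]
    (cs : CoxeterSystem M W) {V : Type*} [AddCommGroup V] [Module ℂ V]
    (ρ : Representation ℂ W V) :
    D.Defines σ cs ρ ↔ ∃ α : Module.Basis B ℂ V, ∀ r : B, ρ (cs.simple r) (α r) = -α r ∧
      ∀ (t : B) (h : r ≠ t), ρ (cs.simple r) (α t) = α t + D.coeff σ r t h • α r := by
  simp only [GGRDatum.Defines, GGRDatum.coeff, Units.val_div_eq_div_val]

open Classical in
/-- The linear form `φ_r` with `r · v = v + φ_r(v) α_r`. -/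
noncomputable def GGRDatum.form (σ : SqrtChoice) (D : GGRDatum M) {V : Type*} [AddCommGroup V]
    [Module ℂ V] (α : Module.Basis B ℂ V) (r : B) : V →ₗ[ℂ] ℂ :=
  α.constr ℂ fun t => if h : r = t then -2 else D.coeff σ r t h

theorem GGRDatum.form_self (σ : SqrtChoice) (D : GGRDatum M) {V : Type*} [AddCommGroup V]
    [Module ℂ V] (α : Module.Basis B ℂ V) (r : B) : D.form σ α r (α r) = -2 := by
  rw [GGRDatum.form, Module.Basis.constr_basis, dif_pos rfl]

theorem GGRDatum.form_of_ne (σ : SqrtChoice) (D : GGRDatum M) {V : Type*} [AddCommGroup V]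
    [Module ℂ V] (α : Module.Basis B ℂ V) {r t : B} (h : r ≠ t) :
    D.form σ α r (α t) = D.coeff σ r t h := by
  rw [GGRDatum.form, Module.Basis.constr_basis, dif_neg h]

/-- For finite `m` the product of the two coefficients is that of the label, hence not `4`, so the
relation needs checking only on the plane, where it is that of the label after rescaling. -/
theorem GGRDatum.isLiftable (σ : SqrtChoice) (D : GGRDatum M) {V : Type*} [AddCommGroup V]
    [Module ℂ V] (α : Module.Basis B ℂ V) :
    M.IsLiftable fun r => transvectionLike (D.form σ α r) (α r) := by
  intro r t
  by_cases h : r = t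
  · subst h
    rw [M.diagonal, pow_one]
    exact transvectionLike_mul_self (D.form_self σ α r)
  · by_cases hm : M r t = 0
    · rw [hm, pow_zero]
    · apply transvectionLike_mul_pow_eq_one (D.form_self σ α r) (D.form_self σ α t)
      · rw [D.form_of_ne σ α h, D.form_of_ne σ α (Ne.symm h), D.coeff_swap σ h, GGRDatum.coeff,
          mul_mul_mul_comm, Units.mul_inv, mul_one]
        exact DihedralLabel.coeff_mul_coeff_ne_four σ hm (D.fam.mem r t h)
      · rw [D.form_of_ne σ α h, D.form_of_ne σ α (Ne.symm h), D.coeff_swap σ h, GGRDatum.coeff]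
        exact dihedralGen_rescale_pow_eq_one ((D.fam.δ r t h).coeff_pow σ M r t (D.fam.mem r t h)) _

theorem GGRDatum.exists_representation (σ : SqrtChoice) (D : GGRDatum M) {W : Type w} [Group W]
    (cs : CoxeterSystem M W) {V : Type*} [AddCommGroup V] [Module ℂ V]
    (α : Module.Basis B ℂ V) :
    ∃ ρ : Representation ℂ W V, IsGeneralizedGeometric cs ρ ∧ D.Defines σ cs ρ := by
  have hρ : ∀ r, cs.lift ⟨_, D.isLiftable σ α⟩ (cs.simple r) =
      transvectionLike (D.form σ α r) (α r) := cs.lift_apply_simple (D.isLiftable σ α)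
  have hv : ∀ r, IsReflectionVector
      (cs.lift ⟨_, D.isLiftable σ α⟩ (cs.simple r)) (α r) := fun r => by
    rw [hρ]
    exact isReflectionVector_transvectionLike (D.form_self σ α r)
  refine ⟨cs.lift ⟨_, D.isLiftable σ α⟩, ⟨fun r => ⟨_, hv r⟩, α, hv⟩,
    (D.defines_iff σ cs _).2 ⟨α, fun r => ⟨(hv r).2.1, fun t h => ?_⟩⟩⟩
  rw [hρ, transvectionLike_apply, D.form_of_ne σ α h]

theorem GGRDatum.exists_ggrep [Finite B] (σ : SqrtChoice) (D : GGRDatum M) {W : Type w} [Group W]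
    (cs : CoxeterSystem M W) : ∃ X : GGRep.{u, w, v} cs, D.Defines σ cs X.ρ := by
  -- Indexing by `Fin` makes the model space independent of the universe of `B`; `ULift` then places
  -- it in the universe asked for.
  let α : Module.Basis B ℂ (ULift.{v} (Fin (Nat.card B) → ℂ)) :=
    ((Pi.basisFun ℂ (Fin (Nat.card B))).map ULift.moduleEquiv.symm).reindex
      (Finite.equivFin B).symm
  obtain ⟨ρ, hρ, hD⟩ := D.exists_representation σ cs α
  exact ⟨⟨_, ρ, hρ⟩, hD⟩

/-! ### Existence of a datum -/

/-- Independent choices at `(r, t)` and `(t, r)` need not be compatible, so the choice is made for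
`r < t` in some linear order and carried over by `i`. -/
theorem exists_antisymmetric_choice {β : Type*} (R : ∀ r t : B, r ≠ t → β → Prop) (i : β → β)
    (hi : ∀ b, i (i b) = b) (hR : ∀ r t h b, R r t h b → R t r h.symm (i b))
    (hex : ∀ r t h, ∃ b, R r t h b) :
    ∃ f : ∀ r t : B, r ≠ t → β, (∀ r t h, R r t h (f r t h)) ∧
      ∀ r t h, f t r h.symm = i (f r t h) := by
  classical
  let _ : LinearOrder B := linearOrderOfSTO WellOrderingRel
  choose g hg using hex
  refine ⟨fun r t h => if r < t then g r t h else i (g t r h.symm), fun r t h => ?_,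
    fun r t h => ?_⟩
  · dsimp only
    split_ifs
    · exact hg r t h
    · exact hR t r h.symm _ (hg t r h.symm)
  · rcases lt_or_gt_of_ne h with hlt | hlt
    · simp [hlt, hlt.not_gt]
    · simp [hlt, hlt.not_gt, hi]

theorem exists_div_eq_of_mul_eq_one {A : Type*} [CommGroup A] (q : ∀ r t : B, r ≠ t → A)
    (hq : ∀ r t h, q t r h.symm = (q r t h)⁻¹) :
    ∃ a : ∀ r t : B, r ≠ t → A, ∀ r t h, a r t h / a t r h.symm = q r t h := by
  classical
  let _ : LinearOrder B := linearOrderOfSTO WellOrderingRel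
  refine ⟨fun r t h => if r < t then q r t h else 1, fun r t h => ?_⟩
  rcases lt_or_gt_of_ne h with hlt | hlt
  · simp [hlt, hlt.not_gt]
  · simp [hlt, hlt.not_gt, hq r t h]

theorem Module.Basis.linearIndependent_pair {V : Type*} [AddCommGroup V] [Module ℂ V]
    (α : Module.Basis B ℂ V) {r t : B} (h : r ≠ t) : LinearIndependent ℂ ![α r, α t] := by
  have := α.linearIndependent.comp ![r, t] (by
    intro i j hij
    fin_cases i <;> fin_cases j <;> simp_all [eq_comm])
  convert this
  ext i
  fin_cases i <;> rfl

theorem IsGeneralizedGeometric.exists_datum (σ : SqrtChoice) {W : Type w} [Group W]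
    {cs : CoxeterSystem M W} {V : Type*} [AddCommGroup V] [Module ℂ V]
    {ρ : Representation ℂ W V} (hρ : IsGeneralizedGeometric cs ρ) :
    ∃ D : GGRDatum M, D.Defines σ cs ρ := by
  obtain ⟨-, α, hα⟩ := hρ
  choose x hx using fun r t => (hα r).exists_apply_eq (α t)
  -- Label and unit are chosen together; the involution keeps the label and inverts the unit, giving
  -- `δ_rt = δ_tr` and `q_tr = q_rt⁻¹` at once.
  obtain ⟨f, hf, hfs⟩ := exists_antisymmetric_choice (B := B)
    (fun r t _ (b : DihedralLabel B × ℂˣ) => b.1 ∈ paramSet M r t ∧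
      x r t = b.1.coeff σ (M r t) r t * b.2 ∧
      x t r = b.1.coeff σ (M r t) t r * (b.2⁻¹ : ℂˣ))
    (fun b => (b.1, b.2⁻¹)) (by simp)
    (by
      rintro r t h ⟨p, q⟩ ⟨h1, h2, h3⟩
      refine ⟨paramSet_comm M r t ▸ h1, ?_, ?_⟩
      · rw [h3, M.symmetric t r]
      · rw [h2, M.symmetric t r, inv_inv])
    (by
      intro r t h
      have hpow : (ρ (cs.simple r) * ρ (cs.simple t)) ^ (M r t) = 1 := by
        rw [← map_mul, ← map_pow, cs.simple_mul_simple_pow, map_one]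
      obtain ⟨p, hp, q, h1, h2⟩ := exists_label σ M h
        (dihedralGen_pow_eq_one (hα r).2.1 (hx r t) (hα t).2.1 (hx t r)
          (α.linearIndependent_pair h) hpow)
      exact ⟨(p, q), hp, h1, h2⟩)
  obtain ⟨a, ha⟩ := exists_div_eq_of_mul_eq_one (fun r t h => (f r t h).2)
    (fun r t h => by rw [hfs r t h])
  refine ⟨⟨⟨fun r t h => (f r t h).1, fun r t h => (hf r t h).1,
    fun r t h => by rw [hfs r t h]⟩, a⟩, ?_⟩
  refine (GGRDatum.defines_iff σ _ cs ρ).2 ⟨α, fun r => ⟨(hα r).2.1, fun t h => ?_⟩⟩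
  rw [hx r t, GGRDatum.coeff, ha, (hf r t h).2.1]

/-! ### Isomorphisms -/

section Iso

variable {W : Type w} [Group W] {cs : CoxeterSystem M W}
  {V V' : Type*} [AddCommGroup V] [Module ℂ V] [AddCommGroup V'] [Module ℂ V']
  {ρ : Representation ℂ W V} {ρ' : Representation ℂ W V'}

theorem IsGeneralizedGeometric.isReflectionVector (hρ : IsGeneralizedGeometric cs ρ)
    {s : B} {v : V} (hv : v ≠ 0) (hs : ρ (cs.simple s) v = -v) :
    IsReflectionVector (ρ (cs.simple s)) v := by
  obtain ⟨α, hα⟩ := hρ.1 s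
  exact hα.of_apply_eq_neg hv hs

/-- An isomorphism sends `α_s` into the `-1` eigenspace of `s`, the line of `β_s`, so it is diagonal
in these bases; `μ_s` is its entry at `s`. -/
theorem GGRDatum.nonempty_equiv_iff {σ : SqrtChoice} {D D' : GGRDatum M}
    (hρ' : IsGeneralizedGeometric cs ρ') (hD : D.Defines σ cs ρ) (hD' : D'.Defines σ cs ρ') :
    Nonempty (ρ.Equiv ρ') ↔
      ∃ μ : B → ℂˣ, ∀ r t h, D'.coeff σ r t h = D.coeff σ r t h * ((μ r / μ t : ℂˣ) : ℂ) := by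
  obtain ⟨α, hα⟩ := (D.defines_iff σ cs ρ).1 hD
  obtain ⟨β, hβ⟩ := (D'.defines_iff σ cs ρ').1 hD'
  constructor
  · rintro ⟨e⟩
    have he : ∀ g v, e.toLinearEquiv (ρ g v) = ρ' g (e.toLinearEquiv v) :=
      fun g v => e.toIntertwiningMap.isIntertwining _ _ g v
    have hβr : ∀ s, IsReflectionVector (ρ' (cs.simple s)) (β s) := fun s =>
      hρ'.isReflectionVector (β.ne_zero s) (hβ s).1
    choose c hc using fun s => (hβr s).exists_eq_smul
      (v := e.toLinearEquiv (α s)) (by rw [← he, (hα s).1, map_neg])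
    have hc0 : ∀ s, c s ≠ 0 := by
      intro s h0
      have := hc s
      rw [h0, zero_smul, LinearEquiv.map_eq_zero_iff] at this
      exact α.ne_zero s this
    refine ⟨fun s => Units.mk0 (c s) (hc0 s), fun r t h => ?_⟩
    have h1 := he (cs.simple r) (α t)
    rw [(hα r).2 t h, map_add, map_smul, hc, hc, map_smul, (hβ r).2 t h, smul_add,
      add_right_inj, smul_smul, smul_smul] at h1
    have h2 := smul_left_injective ℂ (β.ne_zero r) h1
    simp only [Units.val_div_eq_div_val, Units.val_mk0]
    have := hc0 t
    field_simp
    simpa [mul_comm] using h2.symm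
  · rintro ⟨μ, hμ⟩
    let e : V ≃ₗ[ℂ] V' := α.equiv (β.unitsSMul μ) (Equiv.refl B)
    have he : ∀ s, e (α s) = (μ s : ℂ) • β s := fun s => by
      simp [e, Module.Basis.unitsSMul_apply, Units.smul_def]
    have hs : ∀ s v, e.toLinearMap (ρ (cs.simple s) v) = ρ' (cs.simple s) (e.toLinearMap v) := by
      intro s v
      suffices h : e.toLinearMap ∘ₗ ρ (cs.simple s) = ρ' (cs.simple s) ∘ₗ e.toLinearMap from
        LinearMap.congr_fun h v
      refine α.ext fun t => ?_
      simp only [LinearMap.comp_apply, LinearEquiv.coe_coe]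
      by_cases h : s = t
      · subst h
        rw [(hα s).1, map_neg, he, map_smul, (hβ s).1, smul_neg]
      · rw [(hα s).2 t h, map_add, map_smul, he, he, map_smul, (hβ s).2 t h, hμ s t h, smul_add,
          smul_smul, smul_smul, Units.val_div_eq_div_val]
        congr 2
        field_simp
    exact ⟨Representation.Equiv.mk e fun g =>
      LinearMap.ext (cs.map_apply_of_map_simple hs g)⟩

end Iso

/-! ### The invariants of a datum -/

theorem GGRDatum.chainChar_dart (D : GGRDatum M) (d : D.fam.graph.Dart) :
    D.chainChar (GraphC1.dart d) =
      Additive.ofMul (D.a d.snd d.fst d.adj.ne' / D.a d.fst d.snd d.adj.ne) :=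
  GraphC1.lift_dart _ _ d

theorem graphBoundary_dart {G : SimpleGraph B} (d : G.Dart) :
    graphBoundary G (GraphC1.dart d) = FreeAbelianGroup.of d.snd - FreeAbelianGroup.of d.fst :=
  GraphC1.lift_dart _ _ d

theorem GGRDatum.assocChar_apply (D : GGRDatum M) (z : GraphH1 D.fam.graph) :
    D.assocChar z = (D.chainChar z.1).toMul := rfl

theorem GGRDatum.fam_eq_of_coeff_eq {σ : SqrtChoice} {D D' : GGRDatum M} {μ : B → ℂˣ}
    (h : ∀ r t h, D'.coeff σ r t h = D.coeff σ r t h * ((μ r / μ t : ℂˣ) : ℂ)) :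
    D.fam = D'.fam := by
  have key : D.fam.δ = D'.fam.δ := by
    funext r t hrt
    refine DihedralLabel.eq_of_coeff_eq σ hrt (D.fam.mem r t hrt) (D'.fam.mem r t hrt)
      -- `q` collects three rescalings: from the label of `D` to `D`, from `D` to `D'`, and back to
      -- the label of `D'`.
      (q := D.a r t hrt / D.a t r hrt.symm * (μ r / μ t) *
        (D'.a r t hrt / D'.a t r hrt.symm)⁻¹) ?_ ?_
    · have h1 := h r t hrt
      rw [GGRDatum.coeff, ← Units.eq_mul_inv_iff_mul_eq] at h1
      rw [h1, GGRDatum.coeff]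
      simp only [Units.val_mul, mul_assoc]
    · have h1 := h t r hrt.symm
      rw [D'.coeff_swap σ hrt, ← Units.eq_mul_inv_iff_mul_eq] at h1
      rw [h1, D.coeff_swap σ hrt]
      simp only [← Units.val_mul, mul_assoc]
      congr 2
      simp only [mul_inv, inv_div]
  rcases D with ⟨⟨δ, _, _⟩, _⟩
  rcases D' with ⟨⟨δ', _, _⟩, _⟩
  cases key
  rfl

/-- Two data with the same labels define representations that differ by rescaling the basis if and
only if they have the same associated character. -/
theorem GGRDatum.assocChar_eq_iff (σ : SqrtChoice) (F : LabelFamily M)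
    (a a' : ∀ r t : B, r ≠ t → ℂˣ) :
    (GGRDatum.mk F a).assocChar = (GGRDatum.mk F a').assocChar ↔
      ∃ μ : B → ℂˣ, ∀ r t h, (GGRDatum.mk F a').coeff σ r t h =
        (GGRDatum.mk F a).coeff σ r t h * ((μ r / μ t : ℂˣ) : ℂ) := by
  constructor
  · intro h
    -- The two cochains agree on cycles, so their quotient is a coboundary `k ∘ ∂`.
    obtain ⟨k, hk⟩ := AddMonoidHom.exists_comp_eq_of_ker_le (graphBoundary F.graph)
      ((GGRDatum.mk F a').chainChar - (GGRDatum.mk F a).chainChar) (by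
        intro z hz
        rw [AddMonoidHom.mem_ker, AddMonoidHom.sub_apply, sub_eq_zero]
        exact (DFunLike.congr_fun h ⟨z, hz⟩).symm)
    -- The cochain uses `a_t^r / a_r^t` and the coefficient its inverse, which turns `k(t) - k(r)`
    -- into `μ_r / μ_t`.
    refine ⟨fun s => (k (FreeAbelianGroup.of s)).toMul, fun r t hrt => ?_⟩
    by_cases hadj : F.graph.Adj r t
    · have h1 := DFunLike.congr_fun hk (GraphC1.dart ⟨(r, t), hadj⟩)
      rw [AddMonoidHom.comp_apply, graphBoundary_dart, AddMonoidHom.sub_apply,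
        GGRDatum.chainChar_dart, GGRDatum.chainChar_dart, map_sub] at h1
      have h2 := congrArg Additive.toMul h1
      simp only [toMul_sub, toMul_ofMul] at h2
      rw [GGRDatum.coeff, GGRDatum.coeff, mul_assoc, ← Units.val_mul]
      congr 2
      rw [← inv_div (k _).toMul, h2]
      simp only [inv_div]
      rw [← inv_div (a r t hrt), ← mul_div_assoc, mul_inv_cancel, one_div, inv_div]
    · rw [F.graph_adj_iff σ hrt, not_or, not_not] at hadj
      rw [GGRDatum.coeff, GGRDatum.coeff, hadj.1, zero_mul, zero_mul, zero_mul]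
  · rintro ⟨μ, hμ⟩
    have key : (GGRDatum.mk F a').chainChar = (GGRDatum.mk F a).chainChar +
        (FreeAbelianGroup.lift fun s => Additive.ofMul (μ s)).comp (graphBoundary F.graph) := by
      refine GraphC1.hom_ext fun d => ?_
      rw [AddMonoidHom.add_apply, AddMonoidHom.comp_apply, graphBoundary_dart,
        GGRDatum.chainChar_dart, GGRDatum.chainChar_dart, map_sub, FreeAbelianGroup.lift_apply_of,
        FreeAbelianGroup.lift_apply_of, ← ofMul_div, ← ofMul_mul]
      congr 1
      have hne := d.adj.ne
      -- An arrow label has only one nonzero coefficient; cancelling either one determines the ratio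
      -- on the edge.
      rcases (F.graph_adj_iff σ hne).1 d.adj with h0 | h0
      · have h1 := hμ _ _ hne
        rw [GGRDatum.coeff, GGRDatum.coeff, mul_assoc, ← Units.val_mul] at h1
        have h2 := Units.ext (mul_left_cancel₀ h0 h1)
        rw [← inv_inj]
        simpa [mul_comm] using h2
      · have h1 := hμ _ _ hne.symm
        rw [GGRDatum.coeff_swap σ _ hne, GGRDatum.coeff_swap σ _ hne, mul_assoc,
          ← Units.val_mul] at h1
        have h2 := Units.ext (mul_left_cancel₀ h0 h1)
        simpa using h2
    ext z
    rw [GGRDatum.assocChar_apply, GGRDatum.assocChar_apply]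
    have hz : graphBoundary F.graph z.1 = 0 := z.2
    simp [key, hz]

theorem GGRDatum.mk_eq_mk_iff (σ : SqrtChoice) (D D' : GGRDatum M) :
    (⟨D.fam, D.assocChar⟩ : ClassificationData M) = ⟨D'.fam, D'.assocChar⟩ ↔
      ∃ μ : B → ℂˣ, ∀ r t h, D'.coeff σ r t h = D.coeff σ r t h * ((μ r / μ t : ℂˣ) : ℂ) := by
  constructor
  · intro h
    obtain ⟨F, a⟩ := D
    obtain ⟨F', a'⟩ := D'
    obtain ⟨h1, h2⟩ := Sigma.mk.inj_iff.1 h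
    obtain rfl : F = F' := h1
    exact (GGRDatum.assocChar_eq_iff σ F a a').1 (eq_of_heq h2)
  · rintro ⟨μ, hμ⟩
    have h1 := GGRDatum.fam_eq_of_coeff_eq hμ
    obtain ⟨F, a⟩ := D
    obtain ⟨F', a'⟩ := D'
    obtain rfl : F = F' := h1
    exact Sigma.mk.inj_iff.2 ⟨rfl, heq_of_eq ((GGRDatum.assocChar_eq_iff σ F a a').2 ⟨μ, hμ⟩)⟩

theorem exists_datum_of_character (F : LabelFamily M) (χ : AddChar (GraphH1 F.graph) ℂˣ) :
    ∃ D : GGRDatum M, (⟨D.fam, D.assocChar⟩ : ClassificationData M) = ⟨F, χ⟩ := by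
  classical
  -- The character extends from cycles to all chains because `ℂˣ` is divisible. The ratios `a_r^t /
  -- a_t^r` are then the inverses of its values on edges, and `1` elsewhere.
  obtain ⟨k, hk⟩ := (Module.Baer.of_divisible (Additive ℂˣ)).extension_property_addMonoidHom
    (GraphH1 F.graph).subtype (GraphH1 F.graph).subtype_injective
    (AddChar.toAddMonoidHomEquiv χ)
  obtain ⟨a, ha⟩ := exists_div_eq_of_mul_eq_one (B := B) (A := ℂˣ)
    (fun r t _ => if h : F.graph.Adj r t then
      ((k (GraphC1.dart ⟨(r, t), h⟩)).toMul)⁻¹ else 1)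
    (by
      intro r t hrt
      by_cases h : F.graph.Adj r t
      · rw [dif_pos h, dif_pos h.symm, inv_inj]
        have : (⟨(t, r), h.symm⟩ : F.graph.Dart) = SimpleGraph.Dart.symm ⟨(r, t), h⟩ := rfl
        rw [this, GraphC1.dart_symm, map_neg, toMul_neg]
      · rw [dif_neg h, dif_neg (fun h' => h h'.symm), inv_one])
  refine ⟨⟨F, a⟩, Sigma.mk.inj_iff.2 ⟨rfl, heq_of_eq ?_⟩⟩
  have hchain : (GGRDatum.mk F a).chainChar = k := by
    refine GraphC1.hom_ext fun d => ?_
    rw [GGRDatum.chainChar_dart, ← inv_div, ha _ _ d.adj.ne, dif_pos d.adj, inv_inv]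
    rfl
  ext z
  rw [GGRDatum.assocChar_apply, hchain]
  exact congrArg (fun x : Additive ℂˣ => (x.toMul : ℂ)) (DFunLike.congr_fun hk z)

/-! ### Restriction to dihedral subgroups -/

/-- The vectors `a_r^t α_r` and `a_t^r α_t` play the roles of `β_r` and `β_t`: this scaling absorbs
the factor `a_r^t / a_t^r`. -/
theorem GGRDatum.isLocalType {σ : SqrtChoice} {D : GGRDatum M} {W : Type w} [Group W]
    {cs : CoxeterSystem M W} {V : Type*} [AddCommGroup V] [Module ℂ V]
    {ρ : Representation ℂ W V} (hρ : IsGeneralizedGeometric cs ρ) (hD : D.Defines σ cs ρ) :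
    D.fam.IsLocalType σ cs ρ := by
  obtain ⟨α, hα⟩ := (D.defines_iff σ cs ρ).1 hD
  intro r t h
  have hα' : ∀ s, IsReflectionVector (ρ (cs.simple s)) (α s) := fun s =>
    hρ.isReflectionVector (α.ne_zero s) (hα s).1
  obtain ⟨p, hp⟩ : ∃ p, p = D.a r t h := ⟨_, rfl⟩
  obtain ⟨q, hq⟩ : ∃ q, q = D.a t r h.symm := ⟨_, rfl⟩
  have hli : LinearIndependent ℂ ![(p : ℂ) • α r, (q : ℂ) • α t] := by
    convert (α.linearIndependent_pair h).units_smul ![p, q]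
    ext i
    fin_cases i <;> rfl
  have hr : ρ (cs.simple r) ((q : ℂ) • α t) = (q : ℂ) • α t +
      (D.fam.δ r t h).coeff σ (M r t) r t • (p : ℂ) • α r := by
    rw [map_smul, (hα r).2 t h, smul_add, smul_smul, smul_smul, GGRDatum.coeff, ← hp, ← hq,
      Units.val_div_eq_div_val]
    congr 2
    field_simp
  have ht : ρ (cs.simple t) ((p : ℂ) • α r) = (p : ℂ) • α r +
      (D.fam.δ r t h).coeff σ (M r t) t r • (q : ℂ) • α t := by
    rw [map_smul, (hα t).2 r h.symm, smul_add, smul_smul, smul_smul, D.coeff_swap σ h, ← hp, ← hq,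
      inv_div, Units.val_div_eq_div_val]
    congr 2
    field_simp
  have hint : ∀ s v, planeMap ((p : ℂ) • α r) ((q : ℂ) • α t)
      ((D.fam.δ r t h).rep σ M r t h (D.fam.mem r t h)
        ((dihedralMatrix (M r t) (M.off_diagonal r t h)).toCoxeterSystem.simple s) v) =
      (ρ.comp (dihedralHom cs r t h))
        ((dihedralMatrix (M r t) (M.off_diagonal r t h)).toCoxeterSystem.simple s)
        (planeMap ((p : ℂ) • α r) ((q : ℂ) • α t) v) := by
    intro s v
    rw [DihedralLabel.rep, dihedralRep, CoxeterSystem.lift_apply_simple, MonoidHom.comp_apply,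
      dihedralHom, CoxeterSystem.lift_apply_simple]
    fin_cases s
    · exact planeMap_dihedralGen_zero _ (by simp [(hα r).1]) hr v
    · exact planeMap_dihedralGen_one _ (by simp [(hα t).1]) ht v
  refine ⟨(planeMap ((p : ℂ) • α r) ((q : ℂ) • α t)).intertwiningMap_of_isIntertwiningMap _ _
    (CoxeterSystem.map_apply_of_map_simple _ hint), planeMap_injective hli, fun x y hx hy => ?_⟩
  change LinearMap.range (planeMap ((p : ℂ) • α r) ((q : ℂ) • α t)) = _
  rw [range_planeMap, Submodule.span_insert, Submodule.span_insert,
    (hα' r).span_singleton_eq hx, (hα' t).span_singleton_eq hy,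
    Submodule.span_singleton_smul_eq p.isUnit, Submodule.span_singleton_smul_eq q.isUnit]

end Datum

theorem theorem5p3 {B : Type u} [Finite B] {M : CoxeterMatrix B} {W : Type w} [Group W]
    (cs : CoxeterSystem M W) (σ : SqrtChoice) :
    (∀ X : GGRep.{u, w, v} cs, ∃ D : GGRDatum M, D.Defines σ cs X.ρ) ∧
    (∀ D : GGRDatum M, ∃ X : GGRep.{u, w, v} cs, D.Defines σ cs X.ρ) ∧
    ∃ Θ : GGRepClass.{u, w, v} cs → ClassificationData M,
      Function.Bijective Θ ∧
      (∀ (X : GGRep.{u, w, v} cs) (D : GGRDatum M), D.Defines σ cs X.ρ →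
        Θ (Quotient.mk _ X) = ⟨D.fam, D.assocChar⟩) ∧
      (∀ X : GGRep.{u, w, v} cs, (Θ (Quotient.mk _ X)).1.IsLocalType σ cs X.ρ) := by
  have hex : ∀ X : GGRep.{u, w, v} cs, ∃ D : GGRDatum M, D.Defines σ cs X.ρ := fun X =>
    X.isGeneralizedGeometric.exists_datum σ
  -- Stated for arbitrary defining data, this gives at once that `Θ` is well defined, that it is
  -- injective, and that its value does not depend on the datum.
  have hiff : ∀ (X Y : GGRep.{u, w, v} cs) (D D' : GGRDatum M), D.Defines σ cs X.ρ →
      D'.Defines σ cs Y.ρ → (Nonempty (X.ρ.Equiv Y.ρ) ↔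
        (⟨D.fam, D.assocChar⟩ : ClassificationData M) = ⟨D'.fam, D'.assocChar⟩) :=
    fun X Y D D' hX hY => (GGRDatum.nonempty_equiv_iff Y.isGeneralizedGeometric hX hY).trans
      (GGRDatum.mk_eq_mk_iff σ D D').symm
  refine ⟨hex, fun D => D.exists_ggrep σ cs, ?_⟩
  choose D hD using hex
  let Θ : GGRepClass.{u, w, v} cs → ClassificationData M :=
    Quotient.lift (fun X => ⟨(D X).fam, (D X).assocChar⟩)
      fun X Y h => (hiff X Y _ _ (hD X) (hD Y)).1 h
  have hΘ : ∀ (X : GGRep.{u, w, v} cs) (D : GGRDatum M), D.Defines σ cs X.ρ →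
      Θ (Quotient.mk _ X) = ⟨D.fam, D.assocChar⟩ := fun X D' hD' =>
    (hiff X X _ _ (hD X) hD').1 ⟨Representation.Equiv.refl X.ρ⟩
  refine ⟨Θ, ⟨?_, ?_⟩, hΘ, fun X => GGRDatum.isLocalType X.isGeneralizedGeometric (hD X)⟩
  · intro x y
    induction x using Quotient.inductionOn with | _ X
    induction y using Quotient.inductionOn with | _ Y
    exact fun h => Quotient.sound ((hiff X Y _ _ (hD X) (hD Y)).2 h)
  · rintro ⟨F, χ⟩
    obtain ⟨D', hD'⟩ := exists_datum_of_character F χ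
    obtain ⟨X, hX⟩ := D'.exists_ggrep σ cs
    exact ⟨Quotient.mk _ X, (hΘ X D' hX).trans hD'⟩
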